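/- Let $F$ be a finite direct product of fields. Conventions: in an $F$-linear category $\mathfrak A$, the radical $\mathrm{rad}_{\mathfrak A}$ is the two-sided ideal of all $f:A\to B$ such that $\mathrm{id}_A-gf$ is invertible for every $g:B\to A$; put $\overline{\mathfrak A}:=\mathfrak A/\mathrm{rad}_{\mathfrak A}$. $\mathfrak A$ is semi-primary if $\mathrm{rad}_{\mathfrak A}(A,A)$ is nilpotent for every object $A$ and $\overline{\mathfrak A}$ is semi-simple (its endomorphism rings are semi-simple Artinian). If $F$ is a finite direct product of perfect fields, $\mathfrak A$ is a Wedderburn category if it is semi-primary and $\mathrm{End}_{\overline{\mathfrak A}}(A)$ is a finite $F$-module for every $A$. Let $\mathcal C(U),\mathcal C(X),\mathcal C(Z)$ be $F$-linear pseudo-Abelian triangulated categories related by gluing, that is, by six exact $F$-linear functors $j_!,j_*:\mathcal C(U)\to\mathcal C(X)$, $j^*:\mathcal C(X)\to\mathcal C(U)$, $i_*:\mathcal C(Z)\to\mathcal C(X)$, $i^*,i^!:\mathcal C(X)\to\mathcal C(Z)$, with $j_!\dashv j^*\dashv j_*$ and $i^*\dashv i_*\dashv i^!$, satisfying the axioms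 of Beilinson–Bernstein–Deligne for a recollement. Let each of the three categories carry a weight structure $w$, compatibly with the gluing: $j_!,j^*,i^*,i_*$ respect the subcategories of weights $w\le 0$, and $j^*,j_*,i_*,i^!$ respect those of weights $w\ge 0$. Then $i_*:\mathcal C(Z)_{w=0}\to\mathcal C(X)_{w=0}$ is fully faithful with image stable under direct factors, and $j^*$ identifies $\mathcal C(U)_{w=0}$ with the quotient category $\mathcal C(X)_{w=0}/\mathcal C(Z)_{w=0}$. Let $\mathfrak g$ be the two-sided ideal of $\mathcal C(X)_{w=0}$ generated by all morphisms $M\to i_*N$ and $i_*N\to M$, where $N\in\mathcal C(Z)_{w=0}$ and $M\in\mathcal C(X)_{w=0}$ has no non-zero direct factor belonging to $i_*\mathcal C(Z)_{w=0}$; let $\mathfrak g_Z$ be its restriction to $\mathcal C(Z)_{w=0}$, and put $\mathcal C(X)^u_{w=0}:=\mathcal C(X)_{w=0}/\mathfrak g$, $\mathcal C(Z)^u_{w=0}:=\mathcal C(Z)_{w=0}/\mathfrak g_Z$. (a) Assume that $\mathcal C(Z)_{w=0}$ is semi-primary. Then: (1) Every object of $\mathcal C(X)_{w=0}$ is isomorphic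 to a direct sum $M\oplus i_*N$, with $N\in\mathcal C(Z)_{w=0}$ and $M\in\mathcal C(X)_{w=0}$ without non-zero direct factor belonging to $i_*\mathcal C(Z)_{w=0}$. For two such decompositions $M\oplus i_*N\cong M'\oplus i_*N'$ of the same object there are isomorphisms $\alpha:M\to M'$ and $\beta:N\to N'$ such that $\alpha\oplus i_*\beta$ equals the given isomorphism in $\mathcal C(X)^u_{w=0}$; the classes of such $\alpha$ in $\mathcal C(X)^u_{w=0}$ (hence $j^*\alpha$) and of such $\beta$ in $\mathcal C(Z)^u_{w=0}$ are unique. (2) $\mathfrak g$ is contained in $\mathrm{rad}_{\mathcal C(X)_{w=0}}\cap\ker j^*$, and $\mathfrak g(A,A)$ is a nilpotent ideal of $\mathrm{End}(A)$ for every object $A$. (3) $\mathcal C(U)_{w=0}$, $\mathcal C(Z)^u_{w=0}$ and $\mathcal C(X)^u_{w=0}$ are pseudo-Abelian. (4) $j^*$ and $i_*$ induce a canonical equivalence of $F$-linear categories $\mathcal C(X)^u_{w=0}\simeq\mathcal C(U)_{w=0}\times\mathcal C(Z)^u_{w=0}$: its first component is induced by $j^*$, and its second component maps the class of $i_*N$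 to $N$, naturally in $N\in\mathcal C(Z)_{w=0}$, and kills the objects $M$ without non-zero direct factor belonging to $i_*\mathcal C(Z)_{w=0}$. In particular there is a fully faithful $F$-linear functor $j_{!*}:\mathcal C(U)_{w=0}\to\mathcal C(X)^u_{w=0}$ (the intermediate extension) corresponding to $(\mathrm{id},0)$ under this equivalence. (5) This equivalence descends to an equivalence of $F$-linear categories $\overline{\mathcal C(X)_{w=0}}\simeq\overline{\mathcal C(U)_{w=0}}\times\overline{\mathcal C(Z)_{w=0}}$. (b) If both $\mathcal C(Z)_{w=0}$ and $\mathcal C(U)_{w=0}$ are semi-primary, then so is $\mathcal C(X)_{w=0}$. If $F$ is a finite direct product of perfect fields and both $\mathcal C(Z)_{w=0}$ and $\mathcal C(U)_{w=0}$ are Wedderburn categories, then so is $\mathcal C(X)_{w=0}$. -/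

import Mathlib

open CategoryTheory CategoryTheory.Limits CategoryTheory.Pretriangulated

namespace WeightGluing

universe w v v' u u'

/-! ### Two-sided ideals of linear categories and their quotients -/

section Ideals

variable (R : Type w) [CommRing R]

/-- A two-sided ideal of an `R`-linear category: an `R`-submodule of every `Hom(X, Y)`, stable
under composition with arbitrary morphisms on both sides. -/
structure HomIdeal (A : Type u) [Category.{v} A] [Preadditive A] [Linear R A] where
  carrier (X Y : A) : Submodule R (X ⟶ Y)
  comp_left {X Y Z : A} (f : X ⟶ Y) {g : Y ⟶ Z} (hg : g ∈ carrier Y Z) : f ≫ g ∈ carrier X Z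
  comp_right {X Y Z : A} {f : X ⟶ Y} (g : Y ⟶ Z) (hf : f ∈ carrier X Y) : f ≫ g ∈ carrier X Z

variable {R}
variable {A : Type u} [Category.{v} A] [Preadditive A] [Linear R A]
variable {B : Type u'} [Category.{v'} B] [Preadditive B] [Linear R B]

namespace HomIdeal

instance : LE (HomIdeal R A) where
  le I J := ∀ X Y : A, I.carrier X Y ≤ J.carrier X Y

/-- The congruence `f ≡ g` modulo `I`. -/
def rel (I : HomIdeal R A) : HomRel A := fun X Y f g => f - g ∈ I.carrier X Y

instance (I : HomIdeal R A) : Congruence I.rel where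
  equivalence := fun {X Y} =>
    { refl := fun f => by
        change f - f ∈ I.carrier X Y
        simp
      symm := fun {f g} h => by
        change g - f ∈ I.carrier X Y
        rw [← neg_sub]
        exact neg_mem h
      trans := fun {f g k} h h' => by
        change f - k ∈ I.carrier X Y
        rw [← sub_add_sub_cancel f g k]
        exact add_mem h h' }
  comp_left f g g' h := by
    change f ≫ g - f ≫ g' ∈ _
    rw [← Preadditive.comp_sub]
    exact I.comp_left f h
  comp_right g h := by
    change _ ≫ g - _ ≫ g ∈ _
    rw [← Preadditive.sub_comp]
    exact I.comp_right g h

/-- The quotient category `A / I`: same objects, morphisms taken modulo `I`. -/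
abbrev Quot (I : HomIdeal R A) : Type u := CategoryTheory.Quotient I.rel

/-- The projection `A ⥤ A / I`. -/
abbrev proj (I : HomIdeal R A) : A ⥤ I.Quot := CategoryTheory.Quotient.functor I.rel

theorem rel_add (I : HomIdeal R A) ⦃X Y : A⦄ (f₁ f₂ g₁ g₂ : X ⟶ Y)
    (hf : I.rel f₁ f₂) (hg : I.rel g₁ g₂) : I.rel (f₁ + g₁) (f₂ + g₂) := by
  change f₁ + g₁ - (f₂ + g₂) ∈ I.carrier X Y
  rw [add_sub_add_comm]
  exact add_mem hf hg

theorem rel_smul (I : HomIdeal R A) (a : R) ⦃X Y : A⦄ (f₁ f₂ : X ⟶ Y)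
    (hf : I.rel f₁ f₂) : I.rel (a • f₁) (a • f₂) := by
  change a • f₁ - a • f₂ ∈ I.carrier X Y
  rw [← smul_sub]
  exact Submodule.smul_mem _ a hf

instance (I : HomIdeal R A) : Preadditive I.Quot :=
  CategoryTheory.Quotient.preadditive I.rel I.rel_add

instance (I : HomIdeal R A) : I.proj.Additive :=
  CategoryTheory.Quotient.functor_additive I.rel I.rel_add

instance (I : HomIdeal R A) : Linear R I.Quot :=
  CategoryTheory.Quotient.linear R I.rel I.rel_smul

instance (I : HomIdeal R A) : I.proj.Linear R :=
  CategoryTheory.Quotient.linear_functor R I.rel I.rel_smul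

/-- For `I ≤ J`, the induced projection `A / I ⥤ A / J`. -/
def factor {I J : HomIdeal R A} (h : I ≤ J) : I.Quot ⥤ J.Quot :=
  CategoryTheory.Quotient.lift I.rel J.proj fun X Y _ _ hfg =>
    CategoryTheory.Quotient.sound J.rel (h X Y hfg)

/-- The ideal generated by a family of sets of morphisms: finite sums of scalar multiples of
morphisms that factor through a morphism of the family. -/
def generate (S : ∀ X Y : A, Set (X ⟶ Y)) : HomIdeal R A where
  carrier X Y := Submodule.span R
    {f | ∃ (X' Y' : A) (a : X ⟶ X') (s : X' ⟶ Y') (b : Y' ⟶ Y), s ∈ S X' Y' ∧ f = a ≫ s ≫ b}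
  comp_left {X Y Z} f {g} hg := by
    induction hg using Submodule.span_induction with
    | mem x h =>
      obtain ⟨X', Y', a, s, b, hs, rfl⟩ := h
      exact Submodule.subset_span ⟨X', Y', f ≫ a, s, b, hs, by simp⟩
    | zero => simp
    | add x y _ _ hx hy => simpa using add_mem hx hy
    | smul r x _ hx => simpa using Submodule.smul_mem _ r hx
  comp_right {X Y Z f} g hf := by
    induction hf using Submodule.span_induction with
    | mem x h =>
      obtain ⟨X', Y', a, s, b, hs, rfl⟩ := h
      exact Submodule.subset_span ⟨X', Y', a, s, b ≫ g, hs, by simp⟩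
    | zero => simp
    | add x y _ _ hx hy => simpa using add_mem hx hy
    | smul r x _ hx => simpa using Submodule.smul_mem _ r hx

/-- The restriction of an ideal along a linear functor. -/
def comap (i : B ⥤ A) [i.Additive] [i.Linear R] (I : HomIdeal R A) : HomIdeal R B where
  carrier X Y := (I.carrier (i.obj X) (i.obj Y)).comap (i.mapLinearMap R)
  comp_left f g hg := by
    simpa using I.comp_left (i.map f) hg
  comp_right g hf := by
    simpa using I.comp_right (i.map g) hf

/-- `I(X, X)` is a nilpotent ideal of `End(X)`: for some `N`, every product of `N` elements of
`I(X, X)` is zero. -/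
def NilpotentAt (I : HomIdeal R A) (X : A) : Prop :=
  ∃ N : ℕ, ∀ l : List (End X), l.length = N → (∀ f ∈ l, f ∈ I.carrier X X) → l.prod = 0

end HomIdeal

theorem isIso_one_sub_comp_symm {X Y : A} (f : X ⟶ Y) (g : Y ⟶ X)
    (h : IsIso (𝟙 X - f ≫ g)) : IsIso (𝟙 Y - g ≫ f) := by
  obtain ⟨k, hk₁, hk₂⟩ := h
  have h₁ : k - f ≫ g ≫ k = 𝟙 X := by simpa [Preadditive.sub_comp] using hk₁
  have h₂ : k - k ≫ f ≫ g = 𝟙 X := by simpa [Preadditive.comp_sub] using hk₂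
  have h₁' : f ≫ g ≫ k = k - 𝟙 X := by rw [← h₁]; abel
  have h₂' : k ≫ f ≫ g = k - 𝟙 X := by rw [← h₂]; abel
  refine ⟨𝟙 Y + g ≫ k ≫ f, ?_, ?_⟩
  · have e : g ≫ f ≫ g ≫ k ≫ f = g ≫ k ≫ f - g ≫ f := by
      have := congrArg (fun t => g ≫ t ≫ f) h₁'
      simpa [Preadditive.sub_comp, Preadditive.comp_sub] using this
    simp only [Preadditive.sub_comp, Preadditive.comp_add, Category.id_comp, Category.comp_id,
      Category.assoc, e]
    abel
  · have e : g ≫ k ≫ f ≫ g ≫ f = g ≫ k ≫ f - g ≫ f := by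
      have := congrArg (fun t => g ≫ t ≫ f) h₂'
      simpa [Preadditive.sub_comp, Preadditive.comp_sub] using this
    simp only [Preadditive.add_comp, Preadditive.comp_sub, Category.id_comp, Category.comp_id,
      Category.assoc, e]
    abel

variable (R A) in
/-- The (Kelly) radical: `f : X ⟶ Y` lies in it if `id_X - g f` is invertible for all
`g : Y ⟶ X`. -/
def radical : HomIdeal R A where
  carrier X Y :=
    { carrier := {f | ∀ g : Y ⟶ X, IsIso (𝟙 X - f ≫ g)}
      zero_mem' := fun g => by
        simp only [zero_comp, sub_zero]
        infer_instance
      add_mem' := by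
        intro f₁ f₂ h₁ h₂ g
        have i₁ : IsIso (𝟙 X - f₁ ≫ g) := h₁ g
        have i₂ : IsIso (𝟙 X - f₂ ≫ g ≫ inv (𝟙 X - f₁ ≫ g)) := h₂ _
        have e : 𝟙 X - (f₁ + f₂) ≫ g =
            (𝟙 X - f₂ ≫ g ≫ inv (𝟙 X - f₁ ≫ g)) ≫ (𝟙 X - f₁ ≫ g) := by
          rw [Preadditive.sub_comp, Category.assoc, Category.assoc, IsIso.inv_hom_id,
            Category.comp_id, Category.id_comp, Preadditive.add_comp]
          abel
        rw [e]
        infer_instance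
      smul_mem' := by
        intro r f h g
        have := h (r • g)
        simpa using this }
  comp_left {X Y Z} f {g} hg := by
    intro k
    have h := hg (k ≫ f)
    rw [← Category.assoc] at h
    have h' := isIso_one_sub_comp_symm (g ≫ k) f h
    rwa [Category.assoc]
  comp_right {X Y Z f} g hf := by
    intro k
    have h := hf (g ≫ k)
    rwa [Category.assoc]

/-- A linear category with finite direct sums is semi-simple if all its endomorphism rings are
semi-simple (Artinian) rings; equivalently, all modules over the category are semi-simple. -/
def IsSemisimpleCat (A : Type u) [Category.{v} A] [Preadditive A] : Prop :=
  ∀ X : A, IsSemisimpleRing (End X)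

variable (R A) in
/-- Semi-primary categories: the radical of every endomorphism ring is nilpotent, and the
quotient by the radical is semi-simple. -/
def IsSemiprimary : Prop :=
  (∀ X : A, (radical R A).NilpotentAt X) ∧ IsSemisimpleCat (radical R A).Quot

variable (R A) in
/-- Wedderburn categories (over a finite product `R` of perfect fields): semi-primary, with
endomorphisms in the quotient by the radical finite over `R`. -/
def IsWedderburn : Prop :=
  IsSemiprimary R A ∧ ∀ X : (radical R A).Quot, Module.Finite R (X ⟶ X)

/-- Pseudo-Abelian categories: additive, and all idempotents split. -/
def IsPseudoAbelian (A : Type u) [Category.{v} A] [Preadditive A] : Prop :=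
  HasFiniteBiproducts A ∧ IsIdempotentComplete A

variable (R) in
/-- `R`-linear functors. -/
def IsLinearFunctor (T : A ⥤ B) : Prop := T.Additive ∧ T.Linear R

variable (R) in
/-- `R`-linear functors to a product of `R`-linear categories. -/
def IsLinearToProd {D : Type*} [Category* D] [Preadditive D] [Linear R D] (T : A ⥤ B × D) :
    Prop :=
  IsLinearFunctor R (T ⋙ CategoryTheory.Prod.fst B D) ∧
    IsLinearFunctor R (T ⋙ CategoryTheory.Prod.snd B D)

/-! ### Objects without factors in a full subcategory, and un-gluing -/

/-- `M` has no non-zero direct factor belonging to (the image of) `B`. In a pseudo-Abelian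
category, the direct factors of `M` are the same as its retracts. -/
def HasNoFactorFrom (i : B ⥤ A) (M : A) : Prop :=
  ∀ N : B, Nonempty (Retract (i.obj N) M) → IsZero (i.obj N)

/-- The ideal of `A` generated by the morphisms that factor through an object of `B`; the quotient
of `A` by it is the quotient category `A / B`. -/
def imageIdeal (R : Type w) [CommRing R] [Linear R A] (i : B ⥤ A) : HomIdeal R A :=
  HomIdeal.generate fun X Y => {f | ∃ (N : B) (a : X ⟶ i.obj N) (b : i.obj N ⟶ Y), f = a ≫ b}

/-- The ideal of gluing data: it is generated by all morphisms `M ⟶ i N` and `i N ⟶ M`, where `N`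
is in `B`, and `M` has no non-zero direct factor belonging to `B`. -/
def gluingIdeal (R : Type w) [CommRing R] [Linear R A] (i : B ⥤ A) : HomIdeal R A :=
  HomIdeal.generate fun X Y => {_f | (HasNoFactorFrom i X ∧ ∃ N : B, Y = i.obj N) ∨
    ((∃ N : B, X = i.obj N) ∧ HasNoFactorFrom i Y)}

/-- The restriction of the gluing ideal to `B`. -/
def gluingIdealSub (R : Type w) [CommRing R] [Linear R A] [Linear R B] (i : B ⥤ A) [i.Additive]
    [i.Linear R] : HomIdeal R B :=
  (gluingIdeal R i).comap i

/-- The un-glued category `A / g`. -/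
abbrev Unglued (R : Type w) [CommRing R] [Linear R A] (i : B ⥤ A) : Type u :=
  (gluingIdeal R i).Quot

/-- The un-glued category `B / g_B`. -/
abbrev UngluedSub (R : Type w) [CommRing R] [Linear R A] [Linear R B] (i : B ⥤ A) [i.Additive]
    [i.Linear R] : Type u' :=
  (gluingIdealSub R i).Quot

/-- An isomorphism of `X` with a direct sum `M ⊕ i N`, where `M` has no non-zero direct factor
belonging to `B`. -/
structure Decomposition (i : B ⥤ A) (X : A) where
  M : A
  N : B
  noFactor : HasNoFactorFrom i M
  sum : BinaryBicone M (i.obj N)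
  isBilimit : sum.IsBilimit
  iso : X ≅ sum.pt

/-- Morphisms `α` and `β` between the components of two decompositions of `X` are compatible with
the decompositions up to the gluing ideal: the isomorphism `M ⊕ i N ≅ X ≅ M' ⊕ i N'` becomes
equal to `α ⊕ i β` in `A / g`. -/
def Decomposition.Compatible (R : Type w) [CommRing R] [Linear R A] {i : B ⥤ A} {X : A}
    (D D' : Decomposition i X) (α : D.M ⟶ D'.M) (β : D.N ⟶ D'.N) : Prop :=
  (gluingIdeal R i).proj.map (D.sum.inl ≫ D.iso.inv ≫ D'.iso.hom) =
      (gluingIdeal R i).proj.map (α ≫ D'.sum.inl) ∧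
    (gluingIdeal R i).proj.map (D.sum.inr ≫ D.iso.inv ≫ D'.iso.hom) =
      (gluingIdeal R i).proj.map (i.map β ≫ D'.sum.inr)

end Ideals

/-! ### Weight structures -/

section Weights

/-- A weight structure on a triangulated category, with `C_{w ≤ n} := C_{w ≤ 0}[n]` and
`C_{w ≥ n} := C_{w ≥ 0}[n]`. -/
structure WeightStructure (C : Type u) [Category.{v} C] [Preadditive C] [HasZeroObject C]
    [HasShift C ℤ] [∀ n : ℤ, (shiftFunctor C n).Additive] [Pretriangulated C] where
  /-- the objects of `C_{w ≤ 0}` -/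
  le0 : ObjectProperty C
  /-- the objects of `C_{w ≥ 0}` -/
  ge0 : ObjectProperty C
  le0_retract : le0.IsStableUnderRetracts
  ge0_retract : ge0.IsStableUnderRetracts
  /-- `C_{w ≤ 0} ⊆ C_{w ≤ 1}` -/
  le0_le_le1 : le0 ≤ le0.shift (-1 : ℤ)
  /-- `C_{w ≥ 1} ⊆ C_{w ≥ 0}` -/
  ge1_le_ge0 : ge0.shift (-1 : ℤ) ≤ ge0
  orthogonal {X Y : C} (hX : le0 X) (hY : ge0.shift (-1 : ℤ) Y) (f : X ⟶ Y) : f = 0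
  exists_filtration (M : C) : ∃ (X Y : C) (_ : le0 X) (_ : ge0.shift (-1 : ℤ) Y)
    (f : X ⟶ M) (g : M ⟶ Y) (h : Y ⟶ X⟦(1 : ℤ)⟧), Triangle.mk f g h ∈ distTriang C

variable {C : Type u} [Category.{v} C] [Preadditive C] [HasZeroObject C]
    [HasShift C ℤ] [∀ n : ℤ, (shiftFunctor C n).Additive] [Pretriangulated C]

/-- The objects of weight `0`. -/
def WeightStructure.heartProp (W : WeightStructure C) : ObjectProperty C := W.le0 ⊓ W.ge0

/-- The heart `C_{w = 0}`, a full subcategory of `C`. -/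
abbrev WeightStructure.Heart (W : WeightStructure C) : Type u := W.heartProp.FullSubcategory

end Weights

/-! ### Gluing -/

section Gluing

universe w' v₁ v₂ v₃ u₁ u₂ u₃

/-- Gluing data in the sense of Beilinson, Bernstein and Deligne on three `F`-linear triangulated
categories: six exact `F`-linear functors, with the usual adjunctions, such that `j^* i_* = 0`,
the localization triangles are exact, and `i_*`, `j_!`, `j_*` are fully faithful. -/
structure Gluing (F : Type w') [CommRing F]
    (CU : Type u₁) [Category.{v₁} CU] [Preadditive CU] [Linear F CU] [HasZeroObject CU]
    [HasShift CU ℤ] [∀ n : ℤ, (shiftFunctor CU n).Additive] [Pretriangulated CU]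
    (CX : Type u₂) [Category.{v₂} CX] [Preadditive CX] [Linear F CX] [HasZeroObject CX]
    [HasShift CX ℤ] [∀ n : ℤ, (shiftFunctor CX n).Additive] [Pretriangulated CX]
    (CZ : Type u₃) [Category.{v₃} CZ] [Preadditive CZ] [Linear F CZ] [HasZeroObject CZ]
    [HasShift CZ ℤ] [∀ n : ℤ, (shiftFunctor CZ n).Additive] [Pretriangulated CZ] where
  /-- `j_!` -/
  jShriek : CU ⥤ CX
  /-- `j^*` -/
  jStar : CX ⥤ CU
  /-- `j_*` -/
  jLower : CU ⥤ CX
  /-- `i^*` -/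
  iStar : CX ⥤ CZ
  /-- `i_*` -/
  iLower : CZ ⥤ CX
  /-- `i^!` -/
  iShriek : CX ⥤ CZ
  commShift_jShriek : jShriek.CommShift ℤ
  commShift_jStar : jStar.CommShift ℤ
  commShift_jLower : jLower.CommShift ℤ
  commShift_iStar : iStar.CommShift ℤ
  commShift_iLower : iLower.CommShift ℤ
  commShift_iShriek : iShriek.CommShift ℤ
  exact_jShriek : jShriek.IsTriangulated
  exact_jStar : jStar.IsTriangulated
  exact_jLower : jLower.IsTriangulated
  exact_iStar : iStar.IsTriangulated
  exact_iLower : iLower.IsTriangulated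
  exact_iShriek : iShriek.IsTriangulated
  linear_jShriek : jShriek.Linear F
  linear_jStar : jStar.Linear F
  linear_jLower : jLower.Linear F
  linear_iStar : iStar.Linear F
  linear_iLower : iLower.Linear F
  linear_iShriek : iShriek.Linear F
  adj_jShriek : jShriek ⊣ jStar
  adj_jLower : jStar ⊣ jLower
  adj_iStar : iStar ⊣ iLower
  adj_iShriek : iLower ⊣ iShriek
  jStar_iLower (N : CZ) : IsZero (jStar.obj (iLower.obj N))
  triangle_shriek (M : CX) :
    ∃ d : iLower.obj (iStar.obj M) ⟶ (jShriek.obj (jStar.obj M))⟦(1 : ℤ)⟧,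
      Triangle.mk (adj_jShriek.counit.app M) (adj_iStar.unit.app M) d ∈ distTriang CX
  triangle_star (M : CX) :
    ∃ d : jLower.obj (jStar.obj M) ⟶ (iLower.obj (iShriek.obj M))⟦(1 : ℤ)⟧,
      Triangle.mk (adj_iShriek.counit.app M) (adj_jLower.unit.app M) d ∈ distTriang CX
  iLower_full : iLower.Full
  iLower_faithful : iLower.Faithful
  jShriek_full : jShriek.Full
  jShriek_faithful : jShriek.Faithful
  jLower_full : jLower.Full
  jLower_faithful : jLower.Faithful

variable {F : Type w'} [CommRing F]
    {CU : Type u₁} [Category.{v₁} CU] [Preadditive CU] [Linear F CU] [HasZeroObject CU]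
    [HasShift CU ℤ] [∀ n : ℤ, (shiftFunctor CU n).Additive] [Pretriangulated CU]
    {CX : Type u₂} [Category.{v₂} CX] [Preadditive CX] [Linear F CX] [HasZeroObject CX]
    [HasShift CX ℤ] [∀ n : ℤ, (shiftFunctor CX n).Additive] [Pretriangulated CX]
    {CZ : Type u₃} [Category.{v₃} CZ] [Preadditive CZ] [Linear F CZ] [HasZeroObject CZ]
    [HasShift CZ ℤ] [∀ n : ℤ, (shiftFunctor CZ n).Additive] [Pretriangulated CZ]

/-- Weight structures compatible with the gluing: the left adjoints `j_!`, `j^*`, `i^*`, `i_*`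
respect the categories of weights `≤ 0`, and the right adjoints `j^*`, `j_*`, `i_*`, `i^!` those of
weights `≥ 0`. -/
structure Gluing.WeightCompatible (G : Gluing F CU CX CZ) (WU : WeightStructure CU)
    (WX : WeightStructure CX) (WZ : WeightStructure CZ) : Prop where
  jShriek_le (M : CU) (hM : WU.le0 M) : WX.le0 (G.jShriek.obj M)
  jStar_le (M : CX) (hM : WX.le0 M) : WU.le0 (G.jStar.obj M)
  iStar_le (M : CX) (hM : WX.le0 M) : WZ.le0 (G.iStar.obj M)
  iLower_le (M : CZ) (hM : WZ.le0 M) : WX.le0 (G.iLower.obj M)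
  jStar_ge (M : CX) (hM : WX.ge0 M) : WU.ge0 (G.jStar.obj M)
  jLower_ge (M : CU) (hM : WU.ge0 M) : WX.ge0 (G.jLower.obj M)
  iLower_ge (M : CZ) (hM : WZ.ge0 M) : WX.ge0 (G.iLower.obj M)
  iShriek_ge (M : CX) (hM : WX.ge0 M) : WZ.ge0 (G.iShriek.obj M)

namespace Gluing.WeightCompatible

variable {G : Gluing F CU CX CZ} {WU : WeightStructure CU}
    {WX : WeightStructure CX} {WZ : WeightStructure CZ}

/-- The functor `i_*` on hearts. -/
def iHeart (h : G.WeightCompatible WU WX WZ) : WZ.Heart ⥤ WX.Heart :=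
  WX.heartProp.lift (WZ.heartProp.ι ⋙ G.iLower) fun N =>
    ⟨h.iLower_le _ N.property.1, h.iLower_ge _ N.property.2⟩

/-- The functor `j^*` on hearts. -/
def jHeart (h : G.WeightCompatible WU WX WZ) : WX.Heart ⥤ WU.Heart :=
  WU.heartProp.lift (WX.heartProp.ι ⋙ G.jStar) fun M =>
    ⟨h.jStar_le _ M.property.1, h.jStar_ge _ M.property.2⟩

instance (h : G.WeightCompatible WU WX WZ) : h.iHeart.Additive where
  map_add {X Y f g} := by
    let := G.commShift_iLower
    have := G.exact_iLower
    ext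
    exact G.iLower.map_add

instance (h : G.WeightCompatible WU WX WZ) : h.iHeart.Linear F where
  map_smul {X Y} f r := by
    have := G.linear_iLower
    ext
    exact G.iLower.map_smul r f.hom

end Gluing.WeightCompatible

end Gluing

end WeightGluing

open WeightGluing

set_option linter.unusedSectionVars false

/-! The triangulated input reduces to one property of the hearts, `HasApproximations`, for `i = i_*`
fully faithful and `j = j^*` full and essentially surjective: `j` kills the image of `i`, and every
`X` has a morphism `a : i Y ⟶ X` through which all morphisms to `X` killed by `j` factor. Such an
`a` comes from truncating `i^! X` by weights; the localization triangle and orthogonality give the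
factorization. The kernel of `j` then consists of the morphisms factoring through `i`, whence the
quotient description.

Semi-primarity of `B` enters by lifting idempotents. For `f : i N ⟶ X`, the endomorphisms of `N`
that factor through `f` form a left ideal, generated modulo the radical by an idempotent. Splitting
it yields a direct factor `i N'` of `X` that accounts for the whole ideal modulo the radical
(`IsSemiprimary.exists_retract_of_factorIdeal`). If `X` has no factor from `B`, then `N' = 0`, so
`f` is in the radical; hence `gluingIdeal_le_radical`. For `f = a`, the complement of `i N'` has no
factor from `B`; hence `exists_decomposition`. Two decompositions have diagonal comparison maps
invertible modulo the radical, hence invertible.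

The intersection of the radical with the kernel of `j` is nilpotent (`nilpotentAt_inf`): products of
its elements are carried along `a` to products in the radical of `End Y`. This bounds the gluing
ideal, and also the radical of `A` when that of `U` is nilpotent.

Modulo the gluing ideal, morphisms between `M ⊕ i N` and `M' ⊕ i N'` are block diagonal. The functor
`j` sees the first block, and the second is a morphism of `B` modulo the restricted ideal; this is
the equivalence `ungluing`. It reflects radicals, so it descends, and endomorphism rings of `A`
modulo the radical are products of those for `U` and `B`. -/

/-! ### Lifting idempotents in left ideals -/

/-- If `E → S` is surjective with nil kernel and `S` is semi-simple, then every left ideal of `E`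
is generated by an idempotent, up to the kernel. -/
theorem Ideal.exists_isIdempotentElem_mem_of_ker_isNilpotent {E S : Type*} [Ring E] [Ring S]
    [IsSemisimpleRing S] (π : E →+* S) (hπ : Function.Surjective π)
    (hnil : ∀ x ∈ RingHom.ker π, IsNilpotent x) (I : Ideal E) :
    ∃ e ∈ I, IsIdempotentElem e ∧ ∀ x ∈ I, π (x * e) = π x := by
  obtain ⟨s, hs, hI⟩ := IsSemisimpleRing.ideal_eq_span_idempotent (I.map π)
  have hsI : s ∈ I.map π := hI ▸ Ideal.mem_span_singleton_self s
  obtain ⟨a, haI, rfl⟩ := (Ideal.mem_map_iff_of_surjective π hπ).1 hsI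
  have ha : a - a ^ 2 ∈ RingHom.ker π := by
    rw [RingHom.mem_ker, map_sub, map_pow, pow_two, hs.eq, sub_self]
  obtain ⟨n, hn⟩ := hnil _ ha
  -- The exponent is made positive so that the idempotent `1 - (1 - a ^ (n + 1)) ^ (n + 1)` is a
  -- left multiple of `a`, hence stays in the left ideal, and still maps to `π a`.
  have hn' : (a - a ^ 2) ^ (n + 1) = 0 := by rw [pow_succ, hn, zero_mul]
  have hπe : π (1 - (1 - a ^ (n + 1)) ^ (n + 1)) = π a := by
    simp only [map_sub, map_one, map_pow, hs.pow_succ_eq, hs.one_sub.pow_succ_eq, sub_sub_cancel]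
  refine ⟨_, ?_, isIdempotentElem_one_sub_one_sub_pow_pow a (n + 1) hn', fun x hx => ?_⟩
  · have h := (Commute.one_left (1 - a ^ (n + 1))).geom_sum₂_mul (n + 1)
    rw [one_pow] at h
    rw [← h]
    refine I.mul_mem_left _ ?_
    simpa [pow_succ] using I.mul_mem_left (a ^ n) haI
  · have hx' : π x ∈ I.map π := Ideal.mem_map_of_mem π hx
    rw [hI] at hx'
    obtain ⟨t, ht⟩ := Ideal.mem_span_singleton'.1 hx'
    rw [map_mul, hπe, ← ht, mul_assoc, hs.eq]

namespace WeightGluing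

open scoped ZeroObject

universe w v v' u u'

/-! ### Functors on quotients by ideals, nilpotent ideals, and pseudo-Abelian quotients. -/

section Ideals

variable {R : Type w} [CommRing R]
variable {A : Type u} [Category.{v} A] [Preadditive A] [Linear R A]
variable {B : Type u'} [Category.{v'} B] [Preadditive B]

/-- The ring homomorphism on endomorphism rings induced by an additive functor. -/
def mapEndRingHom (P : A ⥤ B) [P.Additive] (X : A) : End X →+* End (P.obj X) where
  toFun f := P.map f
  map_one' := P.map_id X
  map_mul' f g := P.map_comp g f
  map_zero' := P.map_zero X X
  map_add' _ _ := P.map_add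

theorem mapEndRingHom_apply (P : A ⥤ B) [P.Additive] {X : A} (f : X ⟶ X) :
    mapEndRingHom P X f = P.map f := rfl

namespace HomIdeal

variable (I : HomIdeal R A)

theorem proj_map_eq_iff {X Y : A} (f g : X ⟶ Y) :
    I.proj.map f = I.proj.map g ↔ f - g ∈ I.carrier X Y :=
  CategoryTheory.Quotient.functor_map_eq_iff I.rel f g

theorem proj_map_eq_zero_iff {X Y : A} (f : X ⟶ Y) :
    I.proj.map f = 0 ↔ f ∈ I.carrier X Y := by
  rw [← I.proj.map_zero, proj_map_eq_iff, sub_zero]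

theorem proj_map_surjective {X Y : A} (f : I.proj.obj X ⟶ I.proj.obj Y) :
    ∃ g : X ⟶ Y, I.proj.map g = f := I.proj.map_surjective f

section Lift

variable {I} (P : A ⥤ B) [P.Additive]

/-- The functor on `A / I` induced by an additive functor that kills `I`. -/
def lift (hP : ∀ ⦃X Y : A⦄ (f : X ⟶ Y), f ∈ I.carrier X Y → P.map f = 0) : I.Quot ⥤ B :=
  CategoryTheory.Quotient.lift I.rel P fun X Y f g hfg => by
    have h : P.map (f - g) = 0 := hP _ hfg
    rwa [P.map_sub, sub_eq_zero] at h

variable (hP : ∀ ⦃X Y : A⦄ (f : X ⟶ Y), f ∈ I.carrier X Y → P.map f = 0)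

/-- The induced functor restricts to the given one. -/
def projCompLift : I.proj ⋙ lift P hP ≅ P :=
  NatIso.ofComponents (fun X => Iso.refl (P.obj X)) fun f =>
    (Category.comp_id (P.map f)).trans (Category.id_comp (P.map f)).symm

instance : (lift P hP).Additive where
  map_add {X Y f g} := by
    obtain ⟨X⟩ := X
    obtain ⟨Y⟩ := Y
    obtain ⟨f, rfl⟩ := I.proj_map_surjective f
    obtain ⟨g, rfl⟩ := I.proj_map_surjective g
    rw [← I.proj.map_add]
    exact P.map_add

instance [Linear R B] [P.Linear R] : (lift P hP).Linear R where
  map_smul {X Y} f r := by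
    obtain ⟨X⟩ := X
    obtain ⟨Y⟩ := Y
    obtain ⟨f, rfl⟩ := I.proj_map_surjective f
    rw [← I.proj.map_smul]
    exact P.map_smul r f

theorem lift_full [P.Full] : (lift P hP).Full where
  map_surjective {X Y} f := by
    obtain ⟨X⟩ := X
    obtain ⟨Y⟩ := Y
    obtain ⟨f', rfl⟩ := P.map_surjective f
    exact ⟨I.proj.map f', rfl⟩

theorem lift_essSurj [P.EssSurj] : (lift P hP).EssSurj where
  mem_essImage Y := ⟨I.proj.obj (P.objPreimage Y), ⟨P.objObjPreimageIso Y⟩⟩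

theorem lift_faithful (hP' : ∀ ⦃X Y : A⦄ (f : X ⟶ Y), P.map f = 0 → f ∈ I.carrier X Y) :
    (lift P hP).Faithful where
  map_injective {X Y f g} hfg := by
    obtain ⟨X⟩ := X
    obtain ⟨Y⟩ := Y
    obtain ⟨f, rfl⟩ := I.proj_map_surjective f
    obtain ⟨g, rfl⟩ := I.proj_map_surjective g
    rw [proj_map_eq_iff]
    apply hP'
    rw [P.map_sub, sub_eq_zero]
    exact hfg

end Lift

variable {I}

theorem NilpotentAt.mono {I J : HomIdeal R A} {X : A} (hIJ : I.carrier X X ≤ J.carrier X X)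
    (hJ : J.NilpotentAt X) : I.NilpotentAt X := by
  obtain ⟨n, hn⟩ := hJ
  exact ⟨n, fun l hl h => hn l hl fun f hf => hIJ (h f hf)⟩

theorem NilpotentAt.comap [Linear R B] (i : B ⥤ A) [i.Additive] [i.Linear R] [i.Faithful] {X : B}
    (hI : I.NilpotentAt (i.obj X)) : (I.comap i).NilpotentAt X := by
  obtain ⟨n, hn⟩ := hI
  refine ⟨n, fun l hl h => i.map_injective ?_⟩
  rw [i.map_zero]
  change mapEndRingHom i X l.prod = 0
  rw [map_list_prod]
  refine hn _ (by simpa using hl) fun f hf => ?_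
  obtain ⟨g, hg, rfl⟩ := List.mem_map.1 hf
  exact h g hg

theorem NilpotentAt.isNilpotent {X : A} (hI : I.NilpotentAt X) {f : End X}
    (hf : f ∈ I.carrier X X) : IsNilpotent f := by
  obtain ⟨n, hn⟩ := hI
  refine ⟨n, ?_⟩
  rw [← List.prod_replicate]
  exact hn _ (by simp) fun g hg => by rwa [List.eq_of_mem_replicate hg]

theorem NilpotentAt.isNilpotent_of_mem_ker {X : A} (hI : I.NilpotentAt X) (f : End X)
    (hf : f ∈ RingHom.ker (mapEndRingHom I.proj X)) : IsNilpotent f :=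
  hI.isNilpotent ((I.proj_map_eq_zero_iff f).1 hf)

/-- Idempotents lift modulo a nil ideal, and the image of a splitting of the lift is a splitting. -/
theorem isIdempotentComplete_quot [IsIdempotentComplete A] (hI : ∀ X, I.NilpotentAt X) :
    IsIdempotentComplete I.Quot where
  idempotents_split X p hp := by
    obtain ⟨X⟩ := X
    obtain ⟨e, he, hep⟩ := exists_isIdempotentElem_eq_of_ker_isNilpotent
      (mapEndRingHom I.proj X) (hI X).isNilpotent_of_mem_ker p (I.proj_map_surjective p) hp
    obtain ⟨Y, s, r, hsr, hrs⟩ := IsIdempotentComplete.idempotents_split X e he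
    refine ⟨I.proj.obj Y, I.proj.map s, I.proj.map r, ?_, ?_⟩
    · rw [← I.proj.map_comp, hsr, I.proj.map_id]
    · rw [← hep, mapEndRingHom_apply, ← hrs, I.proj.map_comp]

theorem hasZeroObject_quot [HasZeroObject A] : HasZeroObject I.Quot :=
  ⟨_, I.proj.map_isZero (isZero_zero A)⟩

end HomIdeal

theorem hasFiniteBiproducts_of_binary (C : Type*) [Category* C] [Preadditive C] [HasZeroObject C]
    [HasBinaryBiproducts C] : HasFiniteBiproducts C := by
  have : HasFiniteProducts C := hasFiniteProducts_of_has_binary_and_terminal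
  exact HasFiniteBiproducts.of_hasFiniteProducts

theorem HomIdeal.hasFiniteBiproducts_quot (I : HomIdeal R A) [HasFiniteBiproducts A] :
    HasFiniteBiproducts I.Quot := by
  have : HasBinaryBiproducts A := hasBinaryBiproducts_of_finite_biproducts A
  have : HasZeroObject A := hasZeroObject_of_hasFiniteBiproducts A
  have : HasZeroObject I.Quot := I.hasZeroObject_quot
  have : HasBinaryBiproducts I.Quot := ⟨fun X Y => by
    obtain ⟨X⟩ := X
    obtain ⟨Y⟩ := Y
    refine hasBinaryBiproduct_of_total (I.proj.mapBinaryBicone (BinaryBiproduct.bicone X Y)) ?_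
    have h : (biprod.fst ≫ biprod.inl + biprod.snd ≫ biprod.inr : X ⊞ Y ⟶ X ⊞ Y) = 𝟙 _ :=
      biprod.total
    have h' := congrArg (I.proj.map ·) h
    simp only [I.proj.map_add, I.proj.map_comp, I.proj.map_id] at h'
    exact h'⟩
  exact hasFiniteBiproducts_of_binary _

/-! ### The radical -/

theorem mem_radical_iff {X Y : A} (f : X ⟶ Y) :
    f ∈ (radical R A).carrier X Y ↔ ∀ g : Y ⟶ X, IsIso (𝟙 Y - g ≫ f) :=
  ⟨fun h g => isIso_one_sub_comp_symm _ _ (h g), fun h g => isIso_one_sub_comp_symm _ _ (h g)⟩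

variable (R) in
theorem map_mem_radical {R' : Type*} [CommRing R'] [Linear R' B] (P : A ⥤ B) [P.Additive] [P.Full]
    {X Y : A} {f : X ⟶ Y} (hf : f ∈ (radical R A).carrier X Y) :
    P.map f ∈ (radical R' B).carrier (P.obj X) (P.obj Y) := by
  intro g
  obtain ⟨g, rfl⟩ := P.map_surjective g
  have := hf g
  rw [← P.map_comp, ← P.map_id, ← P.map_sub]
  infer_instance

variable (R) in
theorem mem_radical_of_map_mem {R' : Type*} [CommRing R'] [Linear R' B] (P : A ⥤ B) [P.Additive]
    [P.ReflectsIsomorphisms] {X Y : A} {f : X ⟶ Y}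
    (hf : P.map f ∈ (radical R' B).carrier (P.obj X) (P.obj Y)) :
    f ∈ (radical R A).carrier X Y := by
  intro g
  have := hf (P.map g)
  rw [← P.map_comp, ← P.map_id, ← P.map_sub] at this
  exact isIso_of_reflects_iso _ P

/-- An endomorphism congruent to the identity modulo the radical is invertible, so both composites
are isomorphisms. -/
theorem isIso_of_comp_sub_id_mem_radical {X Y : A} (f : X ⟶ Y) (g : Y ⟶ X)
    (h₁ : f ≫ g - 𝟙 X ∈ (radical R A).carrier X X)
    (h₂ : g ≫ f - 𝟙 Y ∈ (radical R A).carrier Y Y) : IsIso f := by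
  have key : ∀ {Z : A} (k : Z ⟶ Z), k - 𝟙 Z ∈ (radical R A).carrier Z Z → IsIso k := by
    intro Z k hk
    -- Testing against `-𝟙 Z` gives invertibility of `𝟙 Z + (k - 𝟙 Z) = k`.
    have := hk (-𝟙 Z)
    simpa using this
  have i₁ := key _ h₁
  have i₂ := key _ h₂
  have : IsSplitMono f := IsSplitMono.mk' ⟨g ≫ inv (f ≫ g), by simp [← Category.assoc]⟩
  have : Epi f := by
    have : Epi (g ≫ f) := inferInstance
    exact epi_of_epi g f
  exact isIso_of_epi_of_isSplitMono f

theorem reflectsIsomorphisms_proj_of_le_radical {I : HomIdeal R A} (hI : I ≤ radical R A) :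
    I.proj.ReflectsIsomorphisms where
  reflects {X Y} f hf := by
    obtain ⟨g, hg⟩ := I.proj_map_surjective (inv (I.proj.map f))
    refine isIso_of_comp_sub_id_mem_radical f g (hI _ _ ?_) (hI _ _ ?_)
    · rw [← I.proj_map_eq_iff, I.proj.map_comp, hg, IsIso.hom_inv_id, I.proj.map_id]
    · rw [← I.proj_map_eq_iff, I.proj.map_comp, hg, IsIso.inv_hom_id, I.proj.map_id]

/-- In a semi-primary category, a left ideal of an endomorphism ring contains an idempotent that
generates it modulo the radical. -/
theorem IsSemiprimary.exists_idempotent (hA : IsSemiprimary R A) (Y : A) (I : Ideal (End Y)) :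
    ∃ e : Y ⟶ Y, (e : End Y) ∈ I ∧ e ≫ e = e ∧
      ∀ f : Y ⟶ Y, (f : End Y) ∈ I → f - e ≫ f ∈ (radical R A).carrier Y Y := by
  have : IsSemisimpleRing (End ((radical R A).proj.obj Y)) := hA.2 _
  obtain ⟨e, heI, he, h⟩ := Ideal.exists_isIdempotentElem_mem_of_ker_isNilpotent
    (mapEndRingHom (radical R A).proj Y) (radical R A).proj.map_surjective
    (hA.1 Y).isNilpotent_of_mem_ker I
  exact ⟨e, heI, he, fun f hf => ((radical R A).proj_map_eq_iff _ _).1 (h f hf).symm⟩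

end Ideals

/-! ### Generated ideals, decompositions, and approximations by the image of `i`. -/

section

variable {R : Type*} [CommRing R]
variable {A : Type*} [Category* A] [Preadditive A] [Linear R A]
variable {B : Type*} [Category* B]
variable {U : Type*} [Category* U] [Preadditive U] [Linear R U]

namespace HomIdeal

theorem subset_generate (S : ∀ X Y : A, Set (X ⟶ Y)) {X Y : A} {f : X ⟶ Y} (hf : f ∈ S X Y) :
    f ∈ (generate (R := R) S).carrier X Y :=
  Submodule.subset_span ⟨X, Y, 𝟙 X, f, 𝟙 Y, hf, by simp⟩

theorem generate_le {S : ∀ X Y : A, Set (X ⟶ Y)} {I : HomIdeal R A}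
    (h : ∀ X Y, ∀ f ∈ S X Y, f ∈ I.carrier X Y) : generate S ≤ I := by
  intro X Y
  refine Submodule.span_le.2 ?_
  rintro _ ⟨X', Y', a, s, b, hs, rfl⟩
  exact I.comp_left a (I.comp_right b (h _ _ _ hs))

variable (R) in
/-- The ideal of morphisms killed by a linear functor. -/
def ker (P : A ⥤ U) [P.Additive] [P.Linear R] : HomIdeal R A where
  carrier X Y := LinearMap.ker (P.mapLinearMap R (X := X) (Y := Y))
  comp_left f g hg := by
    change P.map _ = 0 at hg
    change P.map _ = 0
    rw [P.map_comp, hg, comp_zero]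
  comp_right g hf := by
    change P.map _ = 0 at hf
    change P.map _ = 0
    rw [P.map_comp, hf, zero_comp]

/-- The intersection of two ideals. -/
def inf (I J : HomIdeal R A) : HomIdeal R A where
  carrier X Y := I.carrier X Y ⊓ J.carrier X Y
  comp_left f _ hg := ⟨I.comp_left f hg.1, J.comp_left f hg.2⟩
  comp_right g hf := ⟨I.comp_right g hf.1, J.comp_right g hf.2⟩

theorem list_prod_mem (I : HomIdeal R A) {X : A} {l : List (End X)} (hl : l ≠ [])
    (h : ∀ f ∈ l, f ∈ I.carrier X X) : l.prod ∈ I.carrier X X := by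
  obtain ⟨f, t, rfl⟩ := List.exists_cons_of_ne_nil hl
  rw [List.prod_cons]
  exact I.comp_left (t.prod : X ⟶ X) (h f (by simp))

/-- If a power of `I` is contained in a nilpotent ideal, then `I` is nilpotent. -/
theorem NilpotentAt.of_pow {I J : HomIdeal R A} {X : A} (hJ : J.NilpotentAt X) (m : ℕ)
    (hm : ∀ l : List (End X), l.length = m → (∀ f ∈ l, f ∈ I.carrier X X) →
      l.prod ∈ J.carrier X X) : I.NilpotentAt X := by
  obtain ⟨n, hn⟩ := hJ
  -- Cutting a list into `n` blocks of length `m` turns it into a list of `n` elements of `J` with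
  -- the same product.
  have key : ∀ (n : ℕ) (l : List (End X)), l.length = n * m → (∀ f ∈ l, f ∈ I.carrier X X) →
      ∃ l' : List (End X), l'.length = n ∧ (∀ f ∈ l', f ∈ J.carrier X X) ∧ l'.prod = l.prod := by
    intro n
    induction n with
    | zero =>
      intro l hl _
      rw [Nat.zero_mul, List.length_eq_zero_iff] at hl
      exact ⟨[], rfl, by simp, by rw [hl]⟩
    | succ n ih =>
      intro l hl h
      rw [Nat.succ_mul] at hl
      obtain ⟨l', hl', h', hp⟩ := ih (l.drop m) (by simp [hl])
        fun f hf => h f (List.mem_of_mem_drop hf)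
      refine ⟨(l.take m).prod :: l', by simp [hl'], ?_, ?_⟩
      · intro f hf
        rcases List.mem_cons.1 hf with rfl | hf
        · exact hm _ (by simp [hl]) fun g hg => h g (List.mem_of_mem_take hg)
        · exact h' f hf
      · rw [List.prod_cons, hp, List.prod_take_mul_prod_drop]
  refine ⟨n * m, fun l hl h => ?_⟩
  obtain ⟨l', hl', h', hp⟩ := key n l hl h
  rw [← hp, hn l' hl' h']

end HomIdeal

theorem eq_zero_of_mem_radical_of_idem {X : A} {f : X ⟶ X} (hf : f ∈ (radical R A).carrier X X)
    (hi : f ≫ f = f) : f = 0 := by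
  have := hf (𝟙 X)
  rw [Category.comp_id] at this
  rw [← cancel_mono (𝟙 X - f), Preadditive.comp_sub, hi, Category.comp_id, sub_self, zero_comp]

theorem exists_complement [IsIdempotentComplete A] {N X : A} (s : N ⟶ X) (r : X ⟶ N)
    (h : s ≫ r = 𝟙 N) : ∃ (M : A) (k : M ⟶ X) (p : X ⟶ M), k ≫ p = 𝟙 M ∧
      p ≫ k + r ≫ s = 𝟙 X ∧ s ≫ p = 0 ∧ k ≫ r = 0 := by
  have hi : (r ≫ s) ≫ (r ≫ s) = r ≫ s := by simp [reassoc_of% h]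
  obtain ⟨M, k, p, hkp, hpk⟩ := IsIdempotentComplete.idempotents_split X (𝟙 X - r ≫ s)
    (Idempotents.idem_of_id_sub_idem _ hi)
  refine ⟨M, k, p, hkp, by rw [hpk, sub_add_cancel], ?_, ?_⟩
  · have : s ≫ p ≫ k ≫ p = 0 := by
      rw [reassoc_of% hpk, Preadditive.sub_comp, Preadditive.comp_sub]
      simp [reassoc_of% h]
    rwa [hkp, Category.comp_id] at this
  · have : (k ≫ p ≫ k) ≫ r = 0 := by
      rw [hpk, Category.assoc, Preadditive.sub_comp, Category.assoc, h]
      simp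
    rwa [reassoc_of% hkp] at this

namespace Decomposition

variable {i : B ⥤ A} {X : A} (D : Decomposition i X)

/-- The inclusion of the summand `M`. -/
def inlM : D.M ⟶ X := D.sum.inl ≫ D.iso.inv

/-- The inclusion of the summand `i N`. -/
def inrN : i.obj D.N ⟶ X := D.sum.inr ≫ D.iso.inv

/-- The projection to the summand `M`. -/
def fstM : X ⟶ D.M := D.iso.hom ≫ D.sum.fst

/-- The projection to the summand `i N`. -/
def sndN : X ⟶ i.obj D.N := D.iso.hom ≫ D.sum.snd

@[simp]
theorem inlM_fstM : D.inlM ≫ D.fstM = 𝟙 _ := by simp [inlM, fstM]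

@[simp]
theorem inrN_sndN : D.inrN ≫ D.sndN = 𝟙 _ := by simp [inrN, sndN]

@[simp]
theorem inrN_sndN_assoc {Y : A} (k : i.obj D.N ⟶ Y) :
    D.inrN ≫ D.sndN ≫ k = k := by simp [inrN, sndN]

@[simp]
theorem inlM_sndN : D.inlM ≫ D.sndN = 0 := by simp [inlM, sndN]

@[simp]
theorem inrN_fstM : D.inrN ≫ D.fstM = 0 := by simp [inrN, fstM]

@[simp]
theorem inrN_fstM_assoc {Y : A} (k : D.M ⟶ Y) :
    D.inrN ≫ D.fstM ≫ k = 0 := by simp [inrN, fstM]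

theorem total : D.fstM ≫ D.inlM + D.sndN ≫ D.inrN = 𝟙 X := by
  have h := IsBilimit.binary_total D.isBilimit
  have h' := congrArg (fun t => D.iso.hom ≫ t ≫ D.iso.inv) h
  simpa [fstM, inlM, sndN, inrN] using h'

end Decomposition

variable (i : B ⥤ A) (j : A ⥤ U)

/-- `j` kills the image of `i`, and every object `X` has an approximation `a : i Y ⟶ X` through
which all morphisms to `X` killed by `j` factor. -/
structure HasApproximations : Prop where
  isZero_obj (N : B) : IsZero (j.obj (i.obj N))
  exists_approx (X : A) : ∃ (Y : B) (a : i.obj Y ⟶ X),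
    ∀ (M : A) (g : M ⟶ X), j.map g = 0 → ∃ c : M ⟶ i.obj Y, c ≫ a = g

variable {i j}

theorem mem_gluingIdeal_of_source {M : A} (hM : HasNoFactorFrom i M) {N : B} (f : M ⟶ i.obj N) :
    f ∈ (gluingIdeal R i).carrier _ _ :=
  HomIdeal.subset_generate _ (Or.inl ⟨hM, N, rfl⟩)

theorem mem_gluingIdeal_of_target {M : A} (hM : HasNoFactorFrom i M) {N : B} (f : i.obj N ⟶ M) :
    f ∈ (gluingIdeal R i).carrier _ _ :=
  HomIdeal.subset_generate _ (Or.inr ⟨⟨N, rfl⟩, hM⟩)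

namespace HasApproximations

theorem map_eq_zero_of_source (h : HasApproximations i j) {N : B} {X : A} (f : i.obj N ⟶ X) :
    j.map f = 0 := (h.isZero_obj N).eq_of_src _ _

theorem map_eq_zero_of_target (h : HasApproximations i j) {N : B} {X : A} (f : X ⟶ i.obj N) :
    j.map f = 0 := (h.isZero_obj N).eq_of_tgt _ _

theorem gluingIdeal_le_ker [j.Additive] [j.Linear R] (h : HasApproximations i j) :
    gluingIdeal R i ≤ HomIdeal.ker R j := by
  refine HomIdeal.generate_le ?_
  rintro X Y f (⟨-, N, rfl⟩ | ⟨⟨N, rfl⟩, -⟩)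
  · exact h.map_eq_zero_of_target f
  · exact h.map_eq_zero_of_source f

theorem map_eq_zero_of_mem_gluingIdeal [j.Additive] [j.Linear R] (h : HasApproximations i j)
    {X Y : A} (f : X ⟶ Y) (hf : f ∈ (gluingIdeal R i).carrier X Y) : j.map f = 0 :=
  h.gluingIdeal_le_ker _ _ hf

/-- A morphism killed by `j` factors through the approximation of its target, so it is itself a
generator of the ideal. This is what makes the functor induced by `j` on `A / B` faithful. -/
theorem mem_imageIdeal_iff [j.Additive] [j.Linear R] (h : HasApproximations i j) {X Y : A}
    (f : X ⟶ Y) : f ∈ (imageIdeal R i).carrier X Y ↔ j.map f = 0 := by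
  refine ⟨fun hf => ?_, fun hf => ?_⟩
  · have hle : imageIdeal R i ≤ HomIdeal.ker R j := by
      refine HomIdeal.generate_le ?_
      rintro X Y _ ⟨N, a, b, rfl⟩
      change j.map _ = 0
      rw [j.map_comp, h.map_eq_zero_of_source b, comp_zero]
    exact hle _ _ hf
  · obtain ⟨N, a, ha⟩ := h.exists_approx Y
    obtain ⟨c, hc⟩ := ha X f hf
    exact HomIdeal.subset_generate _ ⟨N, c, a, hc.symm⟩

end HasApproximations

end

/-! ### Semi-primarity of `B`: the gluing ideal, nilpotence, and existence of decompositions. -/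

section

variable {R : Type*} [CommRing R]
variable {A : Type*} [Category* A] [Preadditive A] [Linear R A]
variable {B : Type*} [Category* B] [Preadditive B] [Linear R B]
variable {U : Type*} [Category* U] [Preadditive U] [Linear R U]
variable {i : B ⥤ A} [i.Additive] [i.Full] [i.Faithful] {j : A ⥤ U} [j.Additive] [j.Linear R]

theorem map_mem_radical_iff {X Y : B} (f : X ⟶ Y) :
    i.map f ∈ (radical R A).carrier _ _ ↔ f ∈ (radical R B).carrier _ _ :=
  ⟨mem_radical_of_map_mem R i, map_mem_radical R i⟩

/-- The left ideal of endomorphisms of `N` that factor through a given morphism. -/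
def factorIdeal (i : B ⥤ A) [i.Additive] {N : B} {X : A} (f : i.obj N ⟶ X) : Ideal (End N) where
  carrier := {g : N ⟶ N | ∃ c : X ⟶ i.obj N, i.map g = f ≫ c}
  zero_mem' := ⟨0, by rw [comp_zero]; exact i.map_zero N N⟩
  add_mem' := by
    rintro g g' ⟨c, hc⟩ ⟨c', hc'⟩
    exact ⟨c + c', by rw [Preadditive.comp_add, ← hc, ← hc']; exact i.map_add⟩
  smul_mem' := by
    rintro g' g ⟨c, hc⟩
    exact ⟨c ≫ i.map g', by rw [← Category.assoc, ← hc]; exact i.map_comp g g'⟩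

variable [IsIdempotentComplete B] (hB : IsSemiprimary R B)

include hB

/-- In the semi-primary case, some retract `i N'` of `X` accounts for all endomorphisms of `N`
factoring through `f : i N ⟶ X`, modulo the radical. -/
theorem IsSemiprimary.exists_retract_of_factorIdeal {N : B} {X : A} (f : i.obj N ⟶ X) :
    ∃ (N' : B) (s : N' ⟶ N) (r : N ⟶ N') (c : X ⟶ i.obj N'), s ≫ r = 𝟙 N' ∧
      (i.map s ≫ f) ≫ c = 𝟙 (i.obj N') ∧
      ∀ g : N ⟶ N, (∃ c : X ⟶ i.obj N, i.map g = f ≫ c) →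
        g - r ≫ s ≫ g ∈ (radical R B).carrier N N := by
  obtain ⟨e, ⟨c, hc⟩, he, h⟩ := hB.exists_idempotent N (factorIdeal i f)
  obtain ⟨N', s, r, hsr, hrs⟩ := IsIdempotentComplete.idempotents_split N e he
  refine ⟨N', s, r, c ≫ i.map r, hsr, ?_, fun g hg => ?_⟩
  · rw [Category.assoc, ← reassoc_of% hc, ← i.map_comp, ← i.map_comp, ← hrs,
      Category.assoc, hsr, Category.comp_id, hsr, i.map_id]
  · rw [reassoc_of% hrs]
    exact h g hg

/-- The retract attached to `f` is a factor of `M` from `B`, hence zero. So the idempotent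
generating the factorization ideal vanishes, and every `f ≫ k` comes from the radical of `End N`. -/
theorem mem_radical_of_noFactor_target {M : A} (hM : HasNoFactorFrom i M) {N : B}
    (f : i.obj N ⟶ M) : f ∈ (radical R A).carrier _ _ := by
  obtain ⟨N', s, r, c, hsr, hc, h⟩ := hB.exists_retract_of_factorIdeal f
  have hN' : i.map s = 0 := (hM N' ⟨⟨i.map s ≫ f, c, hc⟩⟩).eq_of_src _ _
  have hs : s = 0 := i.map_injective (by rw [hN', i.map_zero])
  intro k
  obtain ⟨g, hg⟩ := i.map_surjective (f ≫ k)
  have hgr := h g ⟨k, hg⟩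
  rw [hs, zero_comp, comp_zero, sub_zero] at hgr
  have := hgr (𝟙 N)
  rw [Category.comp_id] at this
  rw [← hg, ← i.map_id, ← i.map_sub]
  infer_instance

theorem mem_radical_of_noFactor_source {M : A} (hM : HasNoFactorFrom i M) {N : B}
    (f : M ⟶ i.obj N) : f ∈ (radical R A).carrier _ _ := by
  rw [mem_radical_iff]
  intro k
  -- The test morphism `k : i N ⟶ M` is itself in the radical, and `f` serves as its test morphism.
  have := mem_radical_of_noFactor_target hB hM k f
  exact this

theorem gluingIdeal_le_radical : gluingIdeal R i ≤ radical R A := by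
  refine HomIdeal.generate_le ?_
  rintro X Y f (⟨hX, N, rfl⟩ | ⟨⟨N, rfl⟩, hY⟩)
  · exact mem_radical_of_noFactor_source hB hX f
  · exact mem_radical_of_noFactor_target hB hY f

theorem gluingIdealSub_le_radical [i.Linear R] :
    gluingIdealSub R i ≤ radical R B := fun _ _ f hf =>
  (map_mem_radical_iff f).1 (gluingIdeal_le_radical hB _ _ hf)

namespace HasApproximations

variable (h : HasApproximations i j)
include h

/-- Precomposition with `a : i Y ⟶ X` converts products of elements of the intersection into
products in the radical of `End Y`, which is nilpotent. -/
theorem nilpotentAt_inf (X : A) : ((radical R A).inf (HomIdeal.ker R j)).NilpotentAt X := by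
  obtain ⟨Y, a, ha⟩ := h.exists_approx X
  obtain ⟨m, hm⟩ := hB.1 Y
  set K := (radical R A).inf (HomIdeal.ker R j)
  -- Two factors are needed: `g` is killed by `j`, so `g = c ≫ a`, while `f` puts `t = a ≫ f ≫ c` in
  -- the radical. With `g` alone, nothing would place `a ≫ c` there.
  have pair : ∀ f g : X ⟶ X, f ∈ K.carrier X X → g ∈ K.carrier X X →
      ∃ t : Y ⟶ Y, t ∈ (radical R B).carrier Y Y ∧ a ≫ f ≫ g = i.map t ≫ a := by
    intro f g hf hg
    obtain ⟨c, hc⟩ := ha X g hg.2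
    obtain ⟨t, ht⟩ := i.map_surjective (a ≫ f ≫ c)
    refine ⟨t, (map_mem_radical_iff (i := i) t).1 ?_, by simp [ht, hc]⟩
    rw [ht]
    exact (radical R A).comp_left _ ((radical R A).comp_right _ hf.1)
  have key : ∀ (n : ℕ) (l : List (End X)), l.length = n + n → (∀ f ∈ l, f ∈ K.carrier X X) →
      ∃ l' : List (End Y), l'.length = n ∧ (∀ t ∈ l', t ∈ (radical R B).carrier Y Y) ∧
        a ≫ (l.prod : X ⟶ X) = i.map l'.prod ≫ a := by
    intro n
    induction n with
    | zero =>
      intro l hl _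
      obtain rfl : l = [] := List.length_eq_zero_iff.1 hl
      refine ⟨[], rfl, by simp, ?_⟩
      change a ≫ 𝟙 X = i.map (𝟙 Y) ≫ a
      simp
    | succ n ih =>
      intro l hl hK
      match l, hl, hK with
      | [], hl, _ => simp at hl
      | [_], hl, _ => simp at hl; omega
      | g :: f :: l, hl, hK =>
        obtain ⟨l', hl', hr, hp⟩ := ih l (by simp at hl; omega) fun x hx => hK x (by simp [hx])
        obtain ⟨t, ht, hat⟩ := pair f g (hK f (by simp)) (hK g (by simp))
        refine ⟨t :: l', by simp [hl'], ?_, ?_⟩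
        · intro x hx
          rcases List.mem_cons.1 hx with rfl | hx
          · exact ht
          · exact hr x hx
        · simp only [List.prod_cons, End.mul_def, Category.assoc, Functor.map_comp]
          rw [reassoc_of% hp, hat]
  -- There are `m` pairs, and one more factor to produce the initial `a`. Multiplication in `End X`
  -- reverses composition, so the factor applied first is the last one of the list.
  refine ⟨m + m + 1, fun l hl hK => ?_⟩
  obtain ⟨t, f, rfl⟩ : ∃ t f, l = t ++ [f] := by
    rcases List.eq_nil_or_concat l with rfl | ⟨t, f, rfl⟩
    · simp at hl
    · exact ⟨t, f, by simp⟩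
  obtain ⟨l', hl', hr, hp⟩ := key m t (by simpa using hl) fun x hx => hK x (by simp [hx])
  obtain ⟨c, hc⟩ := ha X f (hK f (by simp)).2
  rw [List.prod_append, List.prod_singleton]
  change (f : X ⟶ X) ≫ (t.prod : X ⟶ X) = 0
  rw [← hc, Category.assoc, hp, hm l' hl' hr]
  exact (congrArg (c ≫ · ≫ a) (i.map_zero Y Y)).trans (by simp)

theorem nilpotentAt_gluingIdeal (X : A) : (gluingIdeal R i).NilpotentAt X :=
  (h.nilpotentAt_inf hB X).mono fun _ hf => Submodule.mem_inf.2
    ⟨gluingIdeal_le_radical hB _ _ hf, h.gluingIdeal_le_ker _ _ hf⟩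

/-- Split off the retract of `X` attached to the approximation `a`. A factor of the complement `M`
coming from `B` would be included in `X` by a morphism killed by `j`, hence factoring through `a`;
this leads to an idempotent of `End Y` lying in the radical. -/
theorem exists_decomposition [IsIdempotentComplete A] (X : A) : Nonempty (Decomposition i X) := by
  obtain ⟨Y, a, ha⟩ := h.exists_approx X
  obtain ⟨N, s, r, c, hsr, hc, hI⟩ := hB.exists_retract_of_factorIdeal a
  obtain ⟨M, k, p, hkp, htot, hsp, hkc⟩ := exists_complement _ c hc
  refine ⟨⟨M, N, ?_, ⟨X, p, c, k, i.map s ≫ a, hkp, hkc, hsp, hc⟩,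
    isBinaryBilimitOfTotal _ htot, Iso.refl X⟩⟩
  rintro N' ⟨⟨u, q, huq⟩⟩
  obtain ⟨d, hd⟩ := ha _ (u ≫ k) (h.map_eq_zero_of_source _)
  have hdq : d ≫ a ≫ p ≫ q = 𝟙 _ := by rw [reassoc_of% hd, reassoc_of% hkp, huq]
  -- The idempotent `g` of `Y` cuts out `N'`. It factors through `a`, and `s ≫ g = 0` because `p`
  -- kills the split summand; hence `g` is in the radical and vanishes.
  obtain ⟨g, hg⟩ := i.map_surjective (a ≫ p ≫ q ≫ d)
  have hgr := hI g ⟨p ≫ q ≫ d, hg⟩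
  have h0 : s ≫ g = 0 := i.map_injective (by
    rw [i.map_comp, hg, i.map_zero, reassoc_of% hsp, zero_comp])
  rw [h0, comp_zero, sub_zero] at hgr
  have hgg : g ≫ g = g := i.map_injective (by
    rw [i.map_comp, hg]
    simp only [Category.assoc]
    rw [reassoc_of% hdq])
  have hg0 := eq_zero_of_mem_radical_of_idem hgr hgg
  rw [IsZero.iff_id_eq_zero]
  calc 𝟙 (i.obj N') = d ≫ (a ≫ p ≫ q ≫ d) ≫ a ≫ p ≫ q := by
        simp only [Category.assoc]
        rw [reassoc_of% hdq, hdq]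
    _ = 0 := by rw [← hg, hg0, i.map_zero, zero_comp, comp_zero]

end HasApproximations

end

/-! ### Uniqueness of decompositions, and morphisms in block form. -/

section

variable {R : Type*} [CommRing R]
variable {A : Type*} [Category* A] [Preadditive A] [Linear R A]
variable {B : Type*} [Category* B] [Preadditive B] [Linear R B]
variable {U : Type*} [Category* U] [Preadditive U] [Linear R U]
variable {i : B ⥤ A} [i.Additive] [i.Linear R] [i.Full] [i.Faithful] {j : A ⥤ U} [j.Additive]
  [j.Linear R]

theorem mem_gluingIdealSub_iff {N N' : B} (f : N ⟶ N') :
    f ∈ (gluingIdealSub R i).carrier N N' ↔ i.map f ∈ (gluingIdeal R i).carrier _ _ := Iff.rfl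

namespace Decomposition

variable {X Y Z : A}

/-- The off-diagonal entries of the comparison of two decompositions are generators of the gluing
ideal. Compatibility therefore amounts to prescribing the diagonal entries modulo this ideal, which
yields existence and uniqueness. -/
theorem compatible_iff (D D' : Decomposition i X) (α : D.M ⟶ D'.M) (β : D.N ⟶ D'.N) :
    D.Compatible R D' α β ↔
      (gluingIdeal R i).proj.map α = (gluingIdeal R i).proj.map (D.inlM ≫ D'.fstM) ∧
      (gluingIdealSub R i).proj.map β =
        (gluingIdealSub R i).proj.map (i.preimage (D.inrN ≫ D'.sndN)) := by
  have hM : D.inlM ≫ D'.sndN ∈ (gluingIdeal R i).carrier _ _ :=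
    mem_gluingIdeal_of_source D.noFactor _
  have hN : D.inrN ≫ D'.fstM ∈ (gluingIdeal R i).carrier _ _ :=
    mem_gluingIdeal_of_target D'.noFactor _
  have ht := IsBilimit.binary_total D'.isBilimit
  have e₁ : D.sum.inl ≫ D.iso.inv ≫ D'.iso.hom =
      (D.inlM ≫ D'.fstM) ≫ D'.sum.inl + (D.inlM ≫ D'.sndN) ≫ D'.sum.inr := by
    simp only [inlM, fstM, sndN, Category.assoc]
    simp only [← Preadditive.comp_add, ht, Category.comp_id]
  have e₂ : D.sum.inr ≫ D.iso.inv ≫ D'.iso.hom =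
      (D.inrN ≫ D'.fstM) ≫ D'.sum.inl + (D.inrN ≫ D'.sndN) ≫ D'.sum.inr := by
    simp only [inrN, fstM, sndN, Category.assoc]
    simp only [← Preadditive.comp_add, ht, Category.comp_id]
  have h₁ := (HomIdeal.proj_map_eq_zero_iff _ _).2 hM
  have h₂ := (HomIdeal.proj_map_eq_zero_iff _ _).2 hN
  have hβ : (gluingIdealSub R i).proj.map β =
        (gluingIdealSub R i).proj.map (i.preimage (D.inrN ≫ D'.sndN)) ↔
      (gluingIdeal R i).proj.map (i.map β) = (gluingIdeal R i).proj.map (D.inrN ≫ D'.sndN) := by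
    rw [HomIdeal.proj_map_eq_iff, HomIdeal.proj_map_eq_iff, mem_gluingIdealSub_iff]
    rw [i.map_sub, i.map_preimage]
  rw [hβ]
  unfold Compatible
  rw [e₁, e₂]
  generalize D.inlM ≫ D'.fstM = a at *
  generalize D.inlM ≫ D'.sndN = b at *
  generalize D.inrN ≫ D'.fstM = c at *
  generalize D.inrN ≫ D'.sndN = d at *
  simp only [Functor.map_add, Functor.map_comp, h₁, h₂, zero_comp, add_zero, zero_add]
  have hinl : ∀ {W : A} (f g : W ⟶ D'.M), (gluingIdeal R i).proj.map f ≫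
      (gluingIdeal R i).proj.map D'.sum.inl = (gluingIdeal R i).proj.map g ≫
      (gluingIdeal R i).proj.map D'.sum.inl → (gluingIdeal R i).proj.map f =
      (gluingIdeal R i).proj.map g := by
    intro W f g hfg
    have := congrArg (· ≫ (gluingIdeal R i).proj.map D'.sum.fst) hfg
    simpa only [← Functor.map_comp, Category.assoc, BinaryBicone.inl_fst, Category.comp_id]
      using this
  have hinr : ∀ {W : A} (f g : W ⟶ i.obj D'.N), (gluingIdeal R i).proj.map f ≫
      (gluingIdeal R i).proj.map D'.sum.inr = (gluingIdeal R i).proj.map g ≫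
      (gluingIdeal R i).proj.map D'.sum.inr → (gluingIdeal R i).proj.map f =
      (gluingIdeal R i).proj.map g := by
    intro W f g hfg
    have := congrArg (· ≫ (gluingIdeal R i).proj.map D'.sum.snd) hfg
    simpa only [← Functor.map_comp, Category.assoc, BinaryBicone.inr_snd, Category.comp_id]
      using this
  constructor
  · rintro ⟨h, h'⟩
    exact ⟨(hinl _ _ h).symm, (hinr _ _ h').symm⟩
  · rintro ⟨h, h'⟩
    rw [h, h']
    exact ⟨rfl, rfl⟩

/-- Trades the path through `i N` for the path through `M`, which is controlled by the gluing ideal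
or by the radical. -/
theorem sndN_inrN_comp (D : Decomposition i Y) {W V : A} (f : W ⟶ Y) (g : Y ⟶ V) :
    (f ≫ D.sndN) ≫ D.inrN ≫ g = f ≫ g - (f ≫ D.fstM) ≫ D.inlM ≫ g := by
  have h := congrArg (fun t => f ≫ t ≫ g) D.total
  simp only [Preadditive.comp_add, Preadditive.add_comp, Category.assoc, Category.id_comp] at h
  simp only [Category.assoc]
  rw [← h]
  abel

variable (R) in
/-- The component `N ⟶ N'` of a morphism `M ⊕ i N ⟶ M' ⊕ i N'`, modulo the gluing ideal. -/
noncomputable def component (D : Decomposition i X) (D' : Decomposition i Y) (f : X ⟶ Y) :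
    (gluingIdealSub R i).proj.obj D.N ⟶ (gluingIdealSub R i).proj.obj D'.N :=
  (gluingIdealSub R i).proj.map (i.preimage (D.inrN ≫ f ≫ D'.sndN))

theorem component_eq (D : Decomposition i X) (D' : Decomposition i Y) {f : X ⟶ Y}
    {g : D.N ⟶ D'.N} (h : i.map g = D.inrN ≫ f ≫ D'.sndN) :
    D.component R D' f = (gluingIdealSub R i).proj.map g := by
  rw [component]
  congr 1
  exact i.map_injective (by rw [i.map_preimage, h])

theorem component_eq_zero_iff (D : Decomposition i X) (D' : Decomposition i Y) (f : X ⟶ Y) :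
    D.component R D' f = 0 ↔ D.inrN ≫ f ≫ D'.sndN ∈ (gluingIdeal R i).carrier _ _ := by
  rw [component, HomIdeal.proj_map_eq_zero_iff, mem_gluingIdealSub_iff, i.map_preimage]

theorem component_id (D : Decomposition i X) : D.component R D (𝟙 X) = 𝟙 _ := by
  rw [D.component_eq D (g := 𝟙 _) (by simp), CategoryTheory.Functor.map_id]

/-- The error is a path `i N ⟶ M' ⟶ i N''`, and its first arrow is in the gluing ideal. -/
theorem component_comp (D : Decomposition i X) (D' : Decomposition i Y) (D'' : Decomposition i Z)
    (f : X ⟶ Y) (g : Y ⟶ Z) :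
    D.component R D'' (f ≫ g) = D.component R D' f ≫ D'.component R D'' g := by
  rw [component, component, component, ← Functor.map_comp, HomIdeal.proj_map_eq_iff,
    mem_gluingIdealSub_iff, i.map_sub, i.map_comp, i.map_preimage, i.map_preimage, i.map_preimage]
  have h := D'.sndN_inrN_comp (D.inrN ≫ f) (g ≫ D''.sndN)
  simp only [Category.assoc] at h ⊢
  rw [h, sub_sub_cancel, ← Category.assoc, ← Category.assoc]
  exact HomIdeal.comp_right _ _ (mem_gluingIdeal_of_target D'.noFactor _)

theorem component_add (D : Decomposition i X) (D' : Decomposition i Y) (f g : X ⟶ Y) :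
    D.component R D' (f + g) = D.component R D' f + D.component R D' g := by
  rw [D.component_eq D' (f := f + g) (g := i.preimage (D.inrN ≫ f ≫ D'.sndN) +
    i.preimage (D.inrN ≫ g ≫ D'.sndN)) (by simp), Functor.map_add]
  rfl

theorem component_smul (D : Decomposition i X) (D' : Decomposition i Y) (r : R) (f : X ⟶ Y) :
    D.component R D' (r • f) = r • D.component R D' f := by
  rw [D.component_eq D' (f := r • f) (g := r • i.preimage (D.inrN ≫ f ≫ D'.sndN)) (by simp),
    Functor.map_smul]
  rfl

variable (R) in
/-- The second components of two decompositions of the same object agree modulo the gluing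
ideal. -/
noncomputable def isoN (D D' : Decomposition i X) :
    (gluingIdealSub R i).proj.obj D.N ≅ (gluingIdealSub R i).proj.obj D'.N where
  hom := D.component R D' (𝟙 X)
  inv := D'.component R D (𝟙 X)
  hom_inv_id := by rw [← component_comp, Category.comp_id, component_id]
  inv_hom_id := by rw [← component_comp, Category.comp_id, component_id]

/-- `j` only sees the summand without factors. -/
noncomputable def isoM (h : HasApproximations i j) (D : Decomposition i X) :
    j.obj D.M ≅ j.obj X where
  hom := j.map D.inlM
  inv := j.map D.fstM
  hom_inv_id := by rw [← j.map_comp, D.inlM_fstM, j.map_id]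
  inv_hom_id := by
    have := congrArg (j.map ·) D.total
    simpa [h.map_eq_zero_of_source D.inrN] using this

/-- The decomposition `0 ⊕ i N` of `i N`. -/
noncomputable def ofObj [HasZeroObject A] (N : B) : Decomposition i (i.obj N) where
  M := (0 : A)
  N := N
  noFactor N' := fun ⟨ρ⟩ => by
    rw [IsZero.iff_id_eq_zero, ← ρ.retract, (isZero_zero A).eq_of_tgt ρ.i 0, zero_comp]
  sum := { pt := i.obj N, fst := 0, snd := 𝟙 _, inl := 0, inr := 𝟙 _,
           inl_fst := (isZero_zero A).eq_of_src _ _ }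
  isBilimit := isBinaryBilimitOfTotal _ (by simp)
  iso := Iso.refl _

theorem component_ofObj [HasZeroObject A] {N N' : B} (f : N ⟶ N') :
    (ofObj (i := i) N).component R (ofObj N') (i.map f) = (gluingIdealSub R i).proj.map f :=
  component_eq _ _ (by
    exact (by simp : i.map f = (𝟙 _ ≫ 𝟙 _) ≫ i.map f ≫ 𝟙 _ ≫ 𝟙 _))

/-- The tautological decomposition of `M ⊕ i N`. -/
noncomputable def ofBiprod [HasBinaryBiproducts A] {M : A} (hM : HasNoFactorFrom i M) (N : B) :
    Decomposition i (M ⊞ i.obj N) where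
  M := M
  N := N
  noFactor := hM
  sum := BinaryBiproduct.bicone _ _
  isBilimit := BinaryBiproduct.isBilimit _ _
  iso := Iso.refl _

section Unique

variable [IsIdempotentComplete B] (hB : IsSemiprimary R B)
include hB

/-- The round trip `M ⟶ M' ⟶ M` differs from the identity by a path through `i N'`, which is in the
radical because `M` has no factor from `B`. -/
theorem isIso_inlM_fstM (D D' : Decomposition i X) : IsIso (D.inlM ≫ D'.fstM) := by
  have key : ∀ D D' : Decomposition i X, (D.inlM ≫ D'.fstM) ≫ D'.inlM ≫ D.fstM - 𝟙 _ ∈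
      (radical R A).carrier _ _ := by
    intro D D'
    have h : (D.inlM ≫ D'.fstM) ≫ D'.inlM ≫ D.fstM - 𝟙 _ =
        -((D.inlM ≫ D'.sndN) ≫ D'.inrN ≫ D.fstM) := by
      rw [sndN_inrN_comp, inlM_fstM]
      abel
    rw [h]
    exact neg_mem (HomIdeal.comp_right _ _ (mem_radical_of_noFactor_source hB D.noFactor _))
  exact isIso_of_comp_sub_id_mem_radical _ _ (key D D') (key D' D)

theorem isIso_inrN_sndN (D D' : Decomposition i X) : IsIso (D.inrN ≫ D'.sndN) := by
  have key : ∀ D D' : Decomposition i X, (D.inrN ≫ D'.sndN) ≫ D'.inrN ≫ D.sndN - 𝟙 _ ∈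
      (radical R A).carrier _ _ := by
    intro D D'
    have h : (D.inrN ≫ D'.sndN) ≫ D'.inrN ≫ D.sndN - 𝟙 _ =
        -((D.inrN ≫ D'.fstM) ≫ D'.inlM ≫ D.sndN) := by
      rw [sndN_inrN_comp, inrN_sndN]
      abel
    rw [h]
    exact neg_mem (HomIdeal.comp_right _ _ (mem_radical_of_noFactor_target hB D'.noFactor _))
  exact isIso_of_comp_sub_id_mem_radical _ _ (key D D') (key D' D)

theorem exists_unique_compatible (h : HasApproximations i j) (D D' : Decomposition i X) :
    ∃ (α : D.M ≅ D'.M) (β : D.N ≅ D'.N), D.Compatible R D' α.hom β.hom ∧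
      ∀ (α' : D.M ≅ D'.M) (β' : D.N ≅ D'.N), D.Compatible R D' α'.hom β'.hom →
        (gluingIdeal R i).proj.map α'.hom = (gluingIdeal R i).proj.map α.hom ∧
        j.map α'.hom = j.map α.hom ∧
        (gluingIdealSub R i).proj.map β'.hom = (gluingIdealSub R i).proj.map β.hom := by
  have := isIso_inlM_fstM hB D D'
  have := isIso_inrN_sndN hB D D'
  refine ⟨asIso (D.inlM ≫ D'.fstM), i.preimageIso (asIso (D.inrN ≫ D'.sndN)),
    (compatible_iff D D' _ _).2 ⟨rfl, rfl⟩, fun α' β' hc => ?_⟩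
  obtain ⟨h₁, h₂⟩ := (compatible_iff D D' _ _).1 hc
  refine ⟨h₁, ?_, h₂⟩
  rw [HomIdeal.proj_map_eq_iff] at h₁
  have h₃ := h.map_eq_zero_of_mem_gluingIdeal _ h₁
  rwa [j.map_sub, sub_eq_zero] at h₃

end Unique

end Decomposition

/-! ### The second component -/

section Second

variable (R) (D : ∀ X : A, Decomposition i X)

/-- The functor sending `M ⊕ i N` to `N`, for a choice of decompositions. -/
noncomputable def secondFunctor : A ⥤ UngluedSub R i where
  obj X := (gluingIdealSub R i).proj.obj (D X).N
  map {X Y} f := (D X).component R (D Y) f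
  map_id X := (D X).component_id
  map_comp {X Y Z} f g := (D X).component_comp (D Y) (D Z) f g

instance : (secondFunctor R D).Additive where
  map_add {X Y f g} := (D X).component_add (D Y) f g

instance : (secondFunctor R D).Linear R where
  map_smul {X Y} f r := (D X).component_smul (D Y) r f

theorem secondFunctor_map_eq_zero {X Y : A} (f : X ⟶ Y)
    (hf : f ∈ (gluingIdeal R i).carrier X Y) : (secondFunctor R D).map f = 0 :=
  ((D X).component_eq_zero_iff (D Y) f).2 (HomIdeal.comp_left _ _ (HomIdeal.comp_right _ _ hf))

/-- On the image of `i`, the second component is the projection. -/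
noncomputable def secondFunctorIso [HasZeroObject A] :
    i ⋙ secondFunctor R D ≅ (gluingIdealSub R i).proj :=
  NatIso.ofComponents (fun N => (D (i.obj N)).isoN R (Decomposition.ofObj N)) fun {N N'} f => by
    -- Both sides of the naturality square are components of the single morphism `i.map f`, from the
    -- chosen decomposition of `i N` to `0 ⊕ i N'`.
    have h := (D (i.obj N)).component_comp (R := R) (D (i.obj N')) (Decomposition.ofObj N')
      (i.map f) (𝟙 _)
    have h' := (D (i.obj N)).component_comp (R := R) (Decomposition.ofObj N)
      (Decomposition.ofObj N') (𝟙 _) (i.map f)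
    rw [Category.comp_id] at h
    rw [Category.id_comp, Decomposition.component_ofObj] at h'
    exact h.symm.trans h'

theorem isZero_secondFunctor_of_noFactor {M : A} (hM : HasNoFactorFrom i M) :
    IsZero ((secondFunctor R D).obj M) := by
  refine (gluingIdealSub R i).proj.map_isZero ?_
  have h := hM (D M).N ⟨⟨(D M).inrN, (D M).sndN, (D M).inrN_sndN⟩⟩
  rw [IsZero.iff_id_eq_zero] at h ⊢
  exact i.map_injective (by rw [i.map_id, i.map_zero, h])

/-- The functor `A / g ⥤ U × B / g_B` induced by `j` and the second component. -/
noncomputable def ungluing (h : HasApproximations i j) : Unglued R i ⥤ U × UngluedSub R i :=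
  (HomIdeal.lift j fun _ _ => h.map_eq_zero_of_mem_gluingIdeal).prod'
    (HomIdeal.lift (secondFunctor R D) fun _ _ => secondFunctor_map_eq_zero R D)

variable (h : HasApproximations i j)

theorem isLinearToProd_ungluing : IsLinearToProd R (ungluing R D h) :=
  ⟨⟨inferInstanceAs (HomIdeal.lift (I := gluingIdeal R i) j
        fun _ _ => h.map_eq_zero_of_mem_gluingIdeal).Additive,
      inferInstanceAs ((HomIdeal.lift (I := gluingIdeal R i) j
        fun _ _ => h.map_eq_zero_of_mem_gluingIdeal).Linear R)⟩,
    ⟨inferInstanceAs (HomIdeal.lift (secondFunctor R D)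
        fun _ _ => secondFunctor_map_eq_zero R D).Additive,
      inferInstanceAs ((HomIdeal.lift (secondFunctor R D)
        fun _ _ => secondFunctor_map_eq_zero R D).Linear R)⟩⟩

theorem ungluing_map {X Y : A} (f : X ⟶ Y) :
    (ungluing R D h).map ((gluingIdeal R i).proj.map f) =
      Prod.mkHom (j.map f) ((D X).component R (D Y) f) := rfl

instance : (ungluing R D h).Faithful where
  map_injective {X Y f g} hfg := by
    obtain ⟨X⟩ := X
    obtain ⟨Y⟩ := Y
    obtain ⟨f, rfl⟩ := HomIdeal.proj_map_surjective _ f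
    obtain ⟨g, rfl⟩ := HomIdeal.proj_map_surjective _ g
    obtain ⟨h₁, h₂⟩ := Prod.ext_iff.1 hfg
    change j.map f = j.map g at h₁
    change (D X).component R (D Y) f = (D X).component R (D Y) g at h₂
    rw [HomIdeal.proj_map_eq_iff]
    rw [← sub_eq_zero, ← j.map_sub] at h₁
    have h₂' : (D X).component R (D Y) (f - g) = 0 := by
      change (secondFunctor R D).map (f - g) = 0
      rw [Functor.map_sub, sub_eq_zero]
      exact h₂
    rw [Decomposition.component_eq_zero_iff] at h₂'
    generalize f - g = f at h₁ h₂'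
    obtain ⟨N, a, ha⟩ := h.exists_approx Y
    obtain ⟨c, rfl⟩ := ha X f h₁
    -- Block expansion of a morphism killed by `j`. From `M`, it passes through `i N` by means of
    -- `c`, so this part is in the gluing ideal; `i N ⟶ M'` is a generator; the remaining block is
    -- in the ideal by assumption.
    have e : c ≫ a = (D X).fstM ≫ ((D X).inlM ≫ c) ≫ a +
        (D X).sndN ≫ ((D X).inrN ≫ c ≫ a ≫ (D Y).fstM) ≫ (D Y).inlM +
        (D X).sndN ≫ ((D X).inrN ≫ (c ≫ a) ≫ (D Y).sndN) ≫ (D Y).inrN := by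
      have h₁ := congrArg (fun t => t ≫ c ≫ a) (D X).total
      have h₂ := congrArg (fun t => ((D X).sndN ≫ (D X).inrN ≫ c ≫ a) ≫ t) (D Y).total
      simp only [Preadditive.comp_add, Preadditive.add_comp, Category.assoc, Category.id_comp,
        Category.comp_id] at h₁ h₂ ⊢
      rw [add_assoc, h₂, h₁]
    rw [e]
    refine add_mem (add_mem ?_ ?_) ?_
    · exact HomIdeal.comp_left _ _ (HomIdeal.comp_right _ _
        (mem_gluingIdeal_of_source (D X).noFactor _))
    · exact HomIdeal.comp_left _ _ (HomIdeal.comp_right _ _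
        (mem_gluingIdeal_of_target (D Y).noFactor _))
    · exact HomIdeal.comp_left _ _ (HomIdeal.comp_right _ _ h₂')

instance [j.Full] : (ungluing R D h).Full where
  map_surjective {X Y f} := by
    obtain ⟨X⟩ := X
    obtain ⟨Y⟩ := Y
    obtain ⟨f₁, f₂⟩ := f
    obtain ⟨u, rfl⟩ := j.map_surjective f₁
    obtain ⟨v, rfl⟩ := HomIdeal.proj_map_surjective _ f₂
    -- Restricting `u` to the summand `M` does not change its image under `j`, and removes its
    -- contribution to the second component.
    refine ⟨(gluingIdeal R i).proj.map ((D X).fstM ≫ (D X).inlM ≫ u +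
      (D X).sndN ≫ i.map v ≫ (D Y).inrN), ?_⟩
    rw [ungluing_map]
    refine Prod.ext ?_ ?_
    · change j.map _ = _
      have e := congrArg (fun t => j.map (t ≫ u)) (D X).total
      simpa [h.map_eq_zero_of_source (D X).inrN, h.map_eq_zero_of_source (D Y).inrN] using e
    · exact Decomposition.component_eq _ _ (by simp)

instance [j.Full] [j.EssSurj] [HasBinaryBiproducts A] : (ungluing R D h).EssSurj where
  mem_essImage Y := by
    obtain ⟨V, N⟩ := Y
    obtain ⟨N⟩ := N
    let X := j.objPreimage V
    -- The `i`-part of the lift of `V` is discarded, being invisible to `j`, and replaced by `N`.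
    let D' := Decomposition.ofBiprod (D X).noFactor N
    exact ⟨(gluingIdeal R i).proj.obj ((D X).M ⊞ i.obj N), ⟨Iso.prod
      ((D'.isoM h).symm ≪≫ (D X).isoM h ≪≫ j.objObjPreimageIso V) ((D _).isoN R D')⟩⟩

end Second

end

/-! ### Linear functors to a product of linear categories -/

section

variable {R : Type*} [CommRing R]
variable {C D D' V : Type*} [Category* C] [Category* D] [Category* D'] [Category* V]
  [Preadditive C] [Preadditive D] [Preadditive D'] [Preadditive V]
  [Linear R C] [Linear R D] [Linear R D'] [Linear R V]

theorem IsLinearFunctor.of_iso {S T : C ⥤ D} (e : S ≅ T) (hS : IsLinearFunctor R S) :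
    IsLinearFunctor R T := by
  obtain ⟨_, _⟩ := hS
  refine ⟨Functor.additive_of_iso e, ⟨fun {X Y} f r => ?_⟩⟩
  rw [← NatIso.naturality_1 e, ← NatIso.naturality_1 e, S.map_smul, Linear.smul_comp,
    Linear.comp_smul]

/-- Linearity of `J` can be tested after the faithful linear functor `T`, one component at a time.
-/
theorem IsLinearFunctor.of_comp {T : C ⥤ D × D'} [T.Faithful] (hT : IsLinearToProd R T)
    {J : V ⥤ C} (hJ : IsLinearToProd R (J ⋙ T)) : IsLinearFunctor R J := by
  obtain ⟨⟨_, _⟩, ⟨_, _⟩⟩ := hT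
  obtain ⟨⟨_, _⟩, ⟨_, _⟩⟩ := hJ
  refine ⟨⟨fun {X Y f g} => T.map_injective (Prod.ext ?_ ?_)⟩,
    ⟨fun {X Y} f r => T.map_injective (Prod.ext ?_ ?_)⟩⟩
  · exact ((J ⋙ T) ⋙ CategoryTheory.Prod.fst D D').map_add.trans
      (T ⋙ CategoryTheory.Prod.fst D D').map_add.symm
  · exact ((J ⋙ T) ⋙ CategoryTheory.Prod.snd D D').map_add.trans
      (T ⋙ CategoryTheory.Prod.snd D D').map_add.symm
  · exact (((J ⋙ T) ⋙ CategoryTheory.Prod.fst D D').map_smul r f).trans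
      ((T ⋙ CategoryTheory.Prod.fst D D').map_smul r (J.map f)).symm
  · exact (((J ⋙ T) ⋙ CategoryTheory.Prod.snd D D').map_smul r f).trans
      ((T ⋙ CategoryTheory.Prod.snd D D').map_smul r (J.map f)).symm

/-- The functor `(id, 0)` lifts along an equivalence with a product. -/
theorem exists_functor_of_equivalence_prod [HasZeroObject D'] (E : C ≌ D × D')
    (hE : IsLinearToProd R E.functor) :
    ∃ J : D ⥤ C, J.Full ∧ J.Faithful ∧ IsLinearFunctor R J ∧
      Nonempty (J ⋙ E.functor ⋙ CategoryTheory.Prod.fst _ _ ≅ 𝟭 D) ∧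
      ∀ M : D, IsZero (E.functor.obj (J.obj M)).2 := by
  let S : D ⥤ D × D' := (𝟭 D).prod' ((Functor.const D).obj 0)
  have hSf : S.Full := ⟨fun {X Y} f => ⟨f.1, Prod.ext rfl ((isZero_zero D').eq_of_src _ _)⟩⟩
  have hSf' : S.Faithful := ⟨fun {X Y f g} hfg => congrArg Prod.fst hfg⟩
  have hS : IsLinearToProd R S :=
    ⟨⟨inferInstanceAs (𝟭 D).Additive, inferInstanceAs ((𝟭 D).Linear R)⟩,
      ⟨⟨(isZero_zero D').eq_of_src _ _⟩, ⟨fun _ _ => (isZero_zero D').eq_of_src _ _⟩⟩⟩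
  let e : (S ⋙ E.inverse) ⋙ E.functor ≅ S :=
    Functor.associator _ _ _ ≪≫ Functor.isoWhiskerLeft S E.counitIso ≪≫ S.rightUnitor
  refine ⟨S ⋙ E.inverse, inferInstance, inferInstance, IsLinearFunctor.of_comp hE ?_,
    ⟨Functor.isoWhiskerRight e (CategoryTheory.Prod.fst D D')⟩, fun M => ?_⟩
  · exact ⟨.of_iso (Functor.isoWhiskerRight e.symm _) hS.1,
      .of_iso (Functor.isoWhiskerRight e.symm _) hS.2⟩
  · exact (isZero_zero D').of_iso ((CategoryTheory.Prod.snd D D').mapIso (e.app M))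

section End

variable {T : C ⥤ D × D'} [T.Full] [T.Faithful] (hT : IsLinearToProd R T)
include hT

/-- The endomorphisms of `X` are pairs of endomorphisms of the components of `T X`. -/
theorem exists_end_linearEquiv_prod (X : C) :
    ∃ e : End X ≃ₗ[R] End (T.obj X).1 × End (T.obj X).2, ∀ f g, e (f * g) = e f * e g := by
  obtain ⟨⟨_, _⟩, ⟨_, _⟩⟩ := hT
  let φ : End X →ₗ[R] End (T.obj X).1 × End (T.obj X).2 :=
    ((T ⋙ CategoryTheory.Prod.fst D D').mapLinearMap R).prod
      ((T ⋙ CategoryTheory.Prod.snd D D').mapLinearMap R)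
  refine ⟨LinearEquiv.ofBijective φ ⟨fun f g hfg => T.map_injective ?_, fun f => ?_⟩,
    fun f g => ?_⟩
  · exact Prod.ext (congrArg Prod.fst hfg) (congrArg Prod.snd hfg)
  · obtain ⟨g, hg⟩ := T.map_surjective (X := X) (Y := X) f
    exact ⟨g, Prod.ext (congrArg Prod.fst hg) (congrArg Prod.snd hg)⟩
  · exact Prod.ext ((T ⋙ CategoryTheory.Prod.fst D D').map_comp g f)
      ((T ⋙ CategoryTheory.Prod.snd D D').map_comp g f)

theorem isSemisimpleCat_of_fullyFaithful_prod (hD : IsSemisimpleCat D) (hD' : IsSemisimpleCat D') :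
    IsSemisimpleCat C := fun X => by
  obtain ⟨e, he⟩ := exists_end_linearEquiv_prod hT X
  have := hD (T.obj X).1
  have := hD' (T.obj X).2
  exact RingEquiv.isSemisimpleRing
    ({ e with map_mul' := he } : End X ≃+* End (T.obj X).1 × End (T.obj X).2).symm

theorem finite_end_of_fullyFaithful_prod (hD : ∀ X : D, Module.Finite R (X ⟶ X))
    (hD' : ∀ X : D', Module.Finite R (X ⟶ X)) (X : C) : Module.Finite R (X ⟶ X) := by
  obtain ⟨e, -⟩ := exists_end_linearEquiv_prod hT X
  have : Module.Finite R (End (T.obj X).1) := hD _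
  have : Module.Finite R (End (T.obj X).2) := hD' _
  exact Module.Finite.equiv e.symm

end End

instance {I J : HomIdeal R C} (hIJ : I ≤ J) : (HomIdeal.factor hIJ).Additive where
  map_add {X Y f g} := by
    obtain ⟨X⟩ := X
    obtain ⟨Y⟩ := Y
    obtain ⟨f, rfl⟩ := I.proj_map_surjective f
    obtain ⟨g, rfl⟩ := I.proj_map_surjective g
    rw [← I.proj.map_add]
    exact J.proj.map_add

instance {I J : HomIdeal R C} (hIJ : I ≤ J) : (HomIdeal.factor hIJ).Linear R where
  map_smul {X Y} f r := by
    obtain ⟨X⟩ := X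
    obtain ⟨Y⟩ := Y
    obtain ⟨f, rfl⟩ := I.proj_map_surjective f
    rw [← I.proj.map_smul]
    exact J.proj.map_smul r f

end

/-! ### Descent to the quotients by the radicals -/

section

variable {R : Type*} [CommRing R]
variable {A : Type*} [Category* A] [Preadditive A] [Linear R A]
variable {B : Type*} [Category* B] [Preadditive B] [Linear R B] [IsIdempotentComplete B]
variable {U : Type*} [Category* U] [Preadditive U] [Linear R U]
variable {i : B ⥤ A} [i.Additive] [i.Linear R] [i.Full] [i.Faithful] {j : A ⥤ U} [j.Additive]
  [j.Linear R] [j.Full]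
variable (hB : IsSemiprimary R B) (D : ∀ X : A, Decomposition i X) (h : HasApproximations i j)

include hB

theorem factor_secondFunctor_map_eq_zero_iff {X Y : A} (f : X ⟶ Y) :
    (HomIdeal.factor (gluingIdealSub_le_radical hB)).map ((secondFunctor R D).map f) = 0 ↔
      (D X).inrN ≫ f ≫ (D Y).sndN ∈ (radical R A).carrier _ _ := by
  refine ((radical R B).proj_map_eq_zero_iff (i.preimage ((D X).inrN ≫ f ≫ (D Y).sndN))).trans ?_
  rw [← map_mem_radical_iff (i := i), i.map_preimage]

theorem map_proj_eq_zero_of_mem_radical {X Y : A} (f : X ⟶ Y) (hf : f ∈ (radical R A).carrier X Y) :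
    (j ⋙ (radical R U).proj).map f = 0 :=
  ((radical R U).proj_map_eq_zero_iff _).2 (map_mem_radical R j hf)

theorem factor_map_eq_zero_of_mem_radical {X Y : A} (f : X ⟶ Y) (hf : f ∈ (radical R A).carrier X Y) :
    (secondFunctor R D ⋙ HomIdeal.factor (gluingIdealSub_le_radical hB)).map f = 0 :=
  (factor_secondFunctor_map_eq_zero_iff hB D f).2
    (HomIdeal.comp_left _ _ (HomIdeal.comp_right _ _ hf))

include h in
-- Invertibility of `𝟙 X - f ≫ g` can be tested in `A / g`, since the gluing ideal is contained in
-- the radical, and then on the two components, since `ungluing` is fully faithful.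
theorem mem_radical_of_components {X Y : A} (f : X ⟶ Y)
    (hj : j.map f ∈ (radical R U).carrier _ _)
    (hN : (D X).inrN ≫ f ≫ (D Y).sndN ∈ (radical R A).carrier _ _) :
    f ∈ (radical R A).carrier X Y := by
  have hN' : (secondFunctor R D).map f ∈ (radical R (UngluedSub R i)).carrier _ _ := by
    refine map_mem_radical R (gluingIdealSub R i).proj ?_
    rwa [← map_mem_radical_iff (i := i), i.map_preimage]
  intro g
  have := reflectsIsomorphisms_proj_of_le_radical (gluingIdeal_le_radical (i := i) hB)
  suffices IsIso ((ungluing R D h).map ((gluingIdeal R i).proj.map (𝟙 X - f ≫ g))) by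
    have := isIso_of_reflects_iso ((gluingIdeal R i).proj.map (𝟙 X - f ≫ g)) (ungluing R D h)
    exact isIso_of_reflects_iso _ (gluingIdeal R i).proj
  rw [isIso_prod_iff]
  constructor
  · have := hj (j.map g)
    rw [← j.map_comp, ← j.map_id, ← j.map_sub] at this
    exact this
  · have := hN' ((secondFunctor R D).map g)
    rw [← Functor.map_comp, ← CategoryTheory.Functor.map_id, ← Functor.map_sub] at this
    exact this

variable (j) in
/-- The functor induced by `j` and the second component on the quotients by the radicals. -/
noncomputable def radicalUngluing :
    (radical R A).Quot ⥤ (radical R U).Quot × (radical R B).Quot :=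
  (HomIdeal.lift (j ⋙ (radical R U).proj) fun _ _ => map_proj_eq_zero_of_mem_radical hB).prod'
    (HomIdeal.lift (secondFunctor R D ⋙ HomIdeal.factor (gluingIdealSub_le_radical hB))
      fun _ _ => factor_map_eq_zero_of_mem_radical hB D)

theorem isLinearToProd_radicalUngluing : IsLinearToProd R (radicalUngluing j hB D) :=
  ⟨⟨inferInstanceAs (HomIdeal.lift (j ⋙ (radical R U).proj)
        fun _ _ => map_proj_eq_zero_of_mem_radical hB).Additive,
      inferInstanceAs ((HomIdeal.lift (j ⋙ (radical R U).proj)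
        fun _ _ => map_proj_eq_zero_of_mem_radical hB).Linear R)⟩,
    ⟨inferInstanceAs (HomIdeal.lift
        (secondFunctor R D ⋙ HomIdeal.factor (gluingIdealSub_le_radical hB))
        fun _ _ => factor_map_eq_zero_of_mem_radical hB D).Additive,
      inferInstanceAs ((HomIdeal.lift
        (secondFunctor R D ⋙ HomIdeal.factor (gluingIdealSub_le_radical hB))
        fun _ _ => factor_map_eq_zero_of_mem_radical hB D).Linear R)⟩⟩

/-- The descended functor is compatible with the one on `A / g`. -/
noncomputable def factorCompRadicalUngluing :
    HomIdeal.factor (gluingIdeal_le_radical hB) ⋙ radicalUngluing j hB D ≅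
      ungluing R D h ⋙ Functor.prod (radical R U).proj
        (HomIdeal.factor (gluingIdealSub_le_radical hB)) :=
  NatIso.ofComponents (fun X => Iso.refl _) fun {X Y} f => by
    obtain ⟨X⟩ := X
    obtain ⟨Y⟩ := Y
    obtain ⟨f, rfl⟩ := HomIdeal.proj_map_surjective _ f
    exact (Category.comp_id _).trans (Category.id_comp _).symm

include h in
theorem faithful_radicalUngluing : (radicalUngluing j hB D).Faithful where
  map_injective {X Y f g} hfg := by
    obtain ⟨X⟩ := X
    obtain ⟨Y⟩ := Y
    obtain ⟨f, rfl⟩ := HomIdeal.proj_map_surjective _ f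
    obtain ⟨g, rfl⟩ := HomIdeal.proj_map_surjective _ g
    obtain ⟨h₁, h₂⟩ := Prod.ext_iff.1 hfg
    change (j ⋙ (radical R U).proj).map f = (j ⋙ (radical R U).proj).map g at h₁
    change (secondFunctor R D ⋙ HomIdeal.factor (gluingIdealSub_le_radical hB)).map f =
      (secondFunctor R D ⋙ HomIdeal.factor (gluingIdealSub_le_radical hB)).map g at h₂
    rw [← sub_eq_zero, ← Functor.map_sub] at h₁ h₂
    rw [HomIdeal.proj_map_eq_iff]
    exact mem_radical_of_components hB D h _ (((radical R U).proj_map_eq_zero_iff _).1 h₁)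
      ((factor_secondFunctor_map_eq_zero_iff hB D _).1 h₂)

include h in
theorem full_radicalUngluing : (radicalUngluing j hB D).Full where
  map_surjective {X Y f} := by
    obtain ⟨X⟩ := X
    obtain ⟨Y⟩ := Y
    obtain ⟨f₁, f₂⟩ := f
    obtain ⟨u, rfl⟩ := HomIdeal.proj_map_surjective _ f₁
    obtain ⟨v, rfl⟩ := HomIdeal.proj_map_surjective _ f₂
    obtain ⟨f, hf⟩ := (ungluing R D h).map_surjective (X := (gluingIdeal R i).proj.obj X)
      (Y := (gluingIdeal R i).proj.obj Y) (Prod.mkHom u ((gluingIdealSub R i).proj.map v))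
    obtain ⟨f, rfl⟩ := HomIdeal.proj_map_surjective _ f
    obtain ⟨h₁, h₂⟩ := Prod.ext_iff.1 hf
    refine ⟨(radical R A).proj.map f, Prod.ext ?_ ?_⟩
    · exact congrArg (radical R U).proj.map h₁
    · exact congrArg (HomIdeal.factor (gluingIdealSub_le_radical (i := i) hB)).map h₂

include h in
theorem essSurj_radicalUngluing [j.EssSurj] [HasBinaryBiproducts A] :
    (radicalUngluing j hB D).EssSurj where
  mem_essImage Y := by
    obtain ⟨⟨V⟩, ⟨N⟩⟩ := Y
    let Z := (ungluing R D h).objPreimage (V, (gluingIdealSub R i).proj.obj N)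
    exact ⟨(HomIdeal.factor (gluingIdeal_le_radical (i := i) hB)).obj Z,
      ⟨(factorCompRadicalUngluing hB D h).app Z ≪≫ (Functor.prod (radical R U).proj
        (HomIdeal.factor (gluingIdealSub_le_radical (i := i) hB))).mapIso
          ((ungluing R D h).objObjPreimageIso _)⟩⟩

end

/-! ### Semi-primary and Wedderburn categories glue -/

section

variable {R : Type*} [CommRing R]
variable {A : Type*} [Category* A] [Preadditive A] [Linear R A] [IsIdempotentComplete A]
variable {B : Type*} [Category* B] [Preadditive B] [Linear R B] [IsIdempotentComplete B]
variable {U : Type*} [Category* U] [Preadditive U] [Linear R U]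
variable {i : B ⥤ A} [i.Additive] [i.Linear R] [i.Full] [i.Faithful] {j : A ⥤ U} [j.Additive]
  [j.Linear R] [j.Full]

theorem HasApproximations.nilpotentAt_radical (h : HasApproximations i j)
    (hB : IsSemiprimary R B) (hU : ∀ V : U, (radical R U).NilpotentAt V) (X : A) :
    (radical R A).NilpotentAt X := by
  obtain ⟨m, hm⟩ := hU (j.obj X)
  -- The functor `j`, being full, maps the radical into the radical, so `m` factors suffice to be
  -- killed by `j`. The extra factor keeps the list nonempty, so that the product is in the radical
  -- even if `m = 0`.
  refine (h.nilpotentAt_inf hB X).of_pow (m + 1) fun l hl hr => Submodule.mem_inf.2 ⟨?_, ?_⟩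
  · exact HomIdeal.list_prod_mem _ (by rintro rfl; simp at hl) hr
  · change mapEndRingHom j X l.prod = 0
    obtain ⟨f, t, rfl⟩ := List.exists_cons_of_ne_nil (l := l) (by rintro rfl; simp at hl)
    rw [List.prod_cons, map_mul, map_list_prod, hm, mul_zero]
    · simpa using hl
    · intro g hg
      obtain ⟨g, hgt, rfl⟩ := List.mem_map.1 hg
      exact map_mem_radical R j (hr g (List.mem_cons_of_mem f hgt))

theorem HasApproximations.isSemiprimary (h : HasApproximations i j)
    (hB : IsSemiprimary R B) (hU : IsSemiprimary R U) : IsSemiprimary R A := by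
  let D X := (h.exists_decomposition hB X).some
  have := full_radicalUngluing hB D h
  have := faithful_radicalUngluing hB D h
  exact ⟨h.nilpotentAt_radical hB hU.1, isSemisimpleCat_of_fullyFaithful_prod
    (isLinearToProd_radicalUngluing (j := j) hB D) hU.2 hB.2⟩

theorem HasApproximations.isWedderburn (h : HasApproximations i j)
    (hB : IsWedderburn R B) (hU : IsWedderburn R U) : IsWedderburn R A := by
  let D X := (h.exists_decomposition hB.1 X).some
  have := full_radicalUngluing hB.1 D h
  have := faithful_radicalUngluing hB.1 D h
  exact ⟨h.isSemiprimary hB.1 hU.1, finite_end_of_fullyFaithful_prod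
    (isLinearToProd_radicalUngluing (j := j) hB.1 D) hU.2 hB.2⟩

end

/-! ### Weight structures: orthogonality, extensions, and the heart. -/

namespace WeightStructure

variable {C : Type*} [Category* C] [Preadditive C] [HasZeroObject C]
    [HasShift C ℤ] [∀ n : ℤ, (shiftFunctor C n).Additive] [Pretriangulated C]
    (W : WeightStructure C)

theorem le0_of_retract {X Y : C} (ρ : Retract X Y) (hY : W.le0 Y) : W.le0 X :=
  have := W.le0_retract
  W.le0.prop_of_retract ρ hY

theorem ge0_of_retract {X Y : C} (ρ : Retract X Y) (hY : W.ge0 Y) : W.ge0 X :=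
  have := W.ge0_retract
  W.ge0.prop_of_retract ρ hY

theorem le0_of_iso {X Y : C} (e : X ≅ Y) (hX : W.le0 X) : W.le0 Y :=
  W.le0_of_retract ⟨e.inv, e.hom, e.inv_hom_id⟩ hX

theorem ge0_of_iso {X Y : C} (e : X ≅ Y) (hX : W.ge0 X) : W.ge0 Y :=
  W.ge0_of_retract ⟨e.inv, e.hom, e.inv_hom_id⟩ hX

/-- `C_{w ≤ 0}` is the left orthogonal of `C_{w ≥ 1}`. -/
theorem le0_of_orthogonal {M : C} (hM : ∀ (Y : C) (f : M ⟶ Y), W.ge0 (Y⟦(-1 : ℤ)⟧) → f = 0) :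
    W.le0 M := by
  obtain ⟨X, Y, hX, hY, f, g, k, hT⟩ := W.exists_filtration M
  -- As `g = 0`, the identity of `M` factors through `X`, so `M` is a retract of `X`.
  obtain ⟨s, hs⟩ := Triangle.coyoneda_exact₂ _ hT (𝟙 M) (by
    change 𝟙 M ≫ g = 0
    rw [Category.id_comp, hM Y g hY])
  exact W.le0_of_retract ⟨s, f, hs.symm⟩ hX

/-- `C_{w ≥ 0}` is the right orthogonal of `C_{w ≤ -1}`. -/
theorem ge0_of_orthogonal {M : C} (hM : ∀ (X : C) (f : X ⟶ M⟦(1 : ℤ)⟧), W.le0 X → f = 0) :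
    W.ge0 M := by
  obtain ⟨X, Y, hX, hY, f, g, k, hT⟩ := W.exists_filtration (M⟦(1 : ℤ)⟧)
  obtain ⟨r, hr⟩ := Triangle.yoneda_exact₂ _ hT (𝟙 _) (by
    change f ≫ 𝟙 _ = 0
    rw [Category.comp_id, hM X f hX])
  have h : W.ge0 ((M⟦(1 : ℤ)⟧)⟦(-1 : ℤ)⟧) :=
    W.ge0_of_retract ((⟨g, r, hr.symm⟩ : Retract _ Y).map (shiftFunctor C (-1 : ℤ))) hY
  exact W.ge0_of_iso ((shiftFunctorCompIsoId C (1 : ℤ) (-1) (by norm_num)).app M) h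

theorem orthogonal_shift {X M : C} (hX : W.le0 X) (hM : W.ge0 M) (f : X ⟶ M⟦(1 : ℤ)⟧) : f = 0 :=
  W.orthogonal hX (W.ge0_of_iso
    ((shiftFunctorCompIsoId C (1 : ℤ) (-1) (by norm_num)).app M).symm hM) f

theorem le0_ext {T : Triangle C} (hT : T ∈ distTriang C) (h₁ : W.le0 T.obj₁) (h₃ : W.le0 T.obj₃) :
    W.le0 T.obj₂ :=
  W.le0_of_orthogonal fun Y f hY => by
    obtain ⟨g, rfl⟩ := T.yoneda_exact₂ hT f (W.orthogonal h₁ hY _)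
    rw [W.orthogonal h₃ hY g, comp_zero]

theorem ge0_ext {T : Triangle C} (hT : T ∈ distTriang C) (h₁ : W.ge0 T.obj₁) (h₃ : W.ge0 T.obj₃) :
    W.ge0 T.obj₂ :=
  W.ge0_of_orthogonal fun X f hX => by
    have hT' := Triangle.shift_distinguished T hT 1
    obtain ⟨g, rfl⟩ := Triangle.coyoneda_exact₂ _ hT' f (W.orthogonal_shift hX h₃ _)
    exact (congrArg (· ≫ _) (W.orthogonal_shift hX h₁ g)).trans zero_comp

theorem le0_of_isZero {X : C} (hX : IsZero X) : W.le0 X :=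
  W.le0_of_orthogonal fun _ f _ => hX.eq_of_src f 0

theorem ge0_of_isZero {X : C} (hX : IsZero X) : W.ge0 X :=
  W.ge0_of_orthogonal fun _ f _ => ((shiftFunctor C (1 : ℤ)).map_isZero hX).eq_of_tgt f 0

/-- An object `M` of weights `≥ 0` is approximated by an object `N` of weight `0`: morphisms from
objects of weights `≤ 0` factor through `N`. -/
theorem exists_heart_approx {M : C} (hM : W.ge0 M) : ∃ (N : W.Heart) (a : N.obj ⟶ M),
    ∃ (Y : C) (g : M ⟶ Y) (k : Y ⟶ N.obj⟦(1 : ℤ)⟧), W.ge0 (Y⟦(-1 : ℤ)⟧) ∧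
      Triangle.mk a g k ∈ distTriang C := by
  obtain ⟨X, Y, hX, hY, f, g, k, hT⟩ := W.exists_filtration M
  -- The rotated triangle presents `X` as an extension of `M` by `Y⟦-1⟧`, both of weights `≥ 0`.
  exact ⟨⟨X, hX, W.ge0_ext (inv_rot_of_distTriang _ hT) hY hM⟩, f, Y, g, k, hY, hT⟩

theorem isIdempotentComplete_heart [IsIdempotentComplete C] : IsIdempotentComplete W.Heart where
  idempotents_split X p hp := by
    obtain ⟨Y, s, r, hsr, hrs⟩ := IsIdempotentComplete.idempotents_split X.obj p.hom
      (congrArg InducedCategory.Hom.hom hp)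
    have ρ : Retract Y X.obj := ⟨s, r, hsr⟩
    exact ⟨⟨Y, W.le0_of_retract ρ X.property.1, W.ge0_of_retract ρ X.property.2⟩,
      ObjectProperty.homMk s, ObjectProperty.homMk r, by ext; exact hsr, by ext; exact hrs⟩

theorem hasFiniteBiproducts_heart : HasFiniteBiproducts W.Heart := by
  have : HasZeroObject W.Heart := ⟨⟨0, W.le0_of_isZero (isZero_zero C),
    W.ge0_of_isZero (isZero_zero C)⟩, by
      rw [IsZero.iff_id_eq_zero]
      exact ObjectProperty.hom_ext _ ((isZero_zero C).eq_of_src _ _)⟩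
  have : HasBinaryBiproducts W.Heart := ⟨fun X Y => by
    have hT := binaryBiproductTriangle_distinguished X.obj Y.obj
    let Z : W.Heart := ⟨X.obj ⊞ Y.obj, W.le0_ext hT X.property.1 Y.property.1,
      W.ge0_ext hT X.property.2 Y.property.2⟩
    refine hasBinaryBiproduct_of_total
      { pt := Z
        fst := ObjectProperty.homMk biprod.fst
        snd := ObjectProperty.homMk biprod.snd
        inl := ObjectProperty.homMk biprod.inl
        inr := ObjectProperty.homMk biprod.inr
        inl_fst := by ext; exact biprod.inl_fst
        inl_snd := by ext; exact biprod.inl_snd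
        inr_fst := by ext; exact biprod.inr_fst
        inr_snd := by ext; exact biprod.inr_snd } ?_
    exact ObjectProperty.hom_ext _ biprod.total⟩
  exact hasFiniteBiproducts_of_binary _

theorem isPseudoAbelian_heart [IsIdempotentComplete C] : IsPseudoAbelian W.Heart :=
  ⟨W.hasFiniteBiproducts_heart, W.isIdempotentComplete_heart⟩

end WeightStructure

/-- The idempotent of `i N` cutting out a retract comes from `N` by full faithfulness; it splits in
`B`, and splittings are unique up to isomorphism. -/
theorem isStableUnderRetracts_essImage {A B : Type*} [Category* A] [Category* B]
    [IsIdempotentComplete B] (i : B ⥤ A) [i.Full] [i.Faithful] :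
    i.essImage.IsStableUnderRetracts where
  of_retract {Y X} ρ := fun ⟨N, ⟨e⟩⟩ => by
    have hρ : (ρ.i ≫ e.inv) ≫ e.hom ≫ ρ.r = 𝟙 Y := by simp
    generalize ρ.i ≫ e.inv = k at hρ
    generalize e.hom ≫ ρ.r = p at hρ
    obtain ⟨N', s, r, hsr, hrs⟩ := IsIdempotentComplete.idempotents_split N (i.preimage (p ≫ k))
      (i.map_injective (by simp [reassoc_of% hρ]))
    have hrs' := congrArg i.map hrs
    rw [i.map_preimage, i.map_comp] at hrs'
    refine ⟨N', ⟨⟨i.map s ≫ p, k ≫ i.map r, ?_, ?_⟩⟩⟩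
    · rw [Category.assoc, ← reassoc_of% hrs', ← i.map_comp, hsr, i.map_id, Category.comp_id,
        ← i.map_comp, hsr, i.map_id]
    · rw [Category.assoc, reassoc_of% hrs', hρ, Category.comp_id, hρ]

/-! ### The functors `i_*` and `j^*` on the hearts of a gluing. -/

section

universe w' v₁ v₂ v₃ u₁ u₂ u₃

variable {F : Type w'} [CommRing F]
    {CU : Type u₁} [Category.{v₁} CU] [Preadditive CU] [Linear F CU] [HasZeroObject CU]
    [HasShift CU ℤ] [∀ n : ℤ, (shiftFunctor CU n).Additive] [Pretriangulated CU]
    {CX : Type u₂} [Category.{v₂} CX] [Preadditive CX] [Linear F CX] [HasZeroObject CX]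
    [HasShift CX ℤ] [∀ n : ℤ, (shiftFunctor CX n).Additive] [Pretriangulated CX]
    {CZ : Type u₃} [Category.{v₃} CZ] [Preadditive CZ] [Linear F CZ] [HasZeroObject CZ]
    [HasShift CZ ℤ] [∀ n : ℤ, (shiftFunctor CZ n).Additive] [Pretriangulated CZ]

theorem Gluing.exists_factor_of_jStar_map_eq_zero (G : Gluing F CU CX CZ) {M X : CX} (g : M ⟶ X)
    (hg : G.jStar.map g = 0) :
    ∃ c : M ⟶ G.iLower.obj (G.iShriek.obj X), c ≫ G.adj_iShriek.counit.app X = g := by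
  obtain ⟨d, hd⟩ := G.triangle_star X
  have hz : g ≫ G.adj_jLower.unit.app X = 0 := by
    let := G.commShift_jLower
    have := G.exact_jLower
    have h := G.adj_jLower.unit.naturality g
    rw [Functor.comp_map, hg, G.jLower.map_zero, comp_zero] at h
    exact h
  obtain ⟨c, hc⟩ := Triangle.coyoneda_exact₂ _ hd g hz
  exact ⟨c, hc.symm⟩

/-- By adjunction, `f` is a morphism `M ⟶ j_* j^* X`. The obstruction to lifting it to `X` is a
morphism to `i_* i^! X⟦1⟧`; on hearts, it vanishes by orthogonality. -/
theorem Gluing.exists_jStar_map_eq (G : Gluing F CU CX CZ) {M X : CX}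
    (f : G.jStar.obj M ⟶ G.jStar.obj X)
    (hz : ∀ k : M ⟶ (G.iLower.obj (G.iShriek.obj X))⟦(1 : ℤ)⟧, k = 0) :
    ∃ g : M ⟶ X, G.jStar.map g = f := by
  obtain ⟨d, hd⟩ := G.triangle_star X
  obtain ⟨g, hg⟩ : ∃ g : M ⟶ X, G.adj_jLower.homEquiv _ _ f = g ≫ G.adj_jLower.unit.app X :=
    Triangle.coyoneda_exact₃ _ hd _ (hz _)
  refine ⟨g, (G.adj_jLower.homEquiv _ _).injective ?_⟩
  rw [hg, Adjunction.homEquiv_unit]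
  exact (G.adj_jLower.unit.naturality g).symm

namespace Gluing.WeightCompatible

variable {G : Gluing F CU CX CZ} {WU : WeightStructure CU}
    {WX : WeightStructure CX} {WZ : WeightStructure CZ} (h : G.WeightCompatible WU WX WZ)

instance : h.iHeart.Faithful where
  map_injective {X Y f g} hfg := by
    have := G.iLower_faithful
    exact ObjectProperty.hom_ext _ (G.iLower.map_injective (WX.heartProp.ι.congr_map hfg))

instance : h.iHeart.Full where
  map_surjective {X Y} f := by
    have := G.iLower_full
    obtain ⟨g, hg⟩ := G.iLower.map_surjective f.hom
    exact ⟨ObjectProperty.homMk g, ObjectProperty.hom_ext _ hg⟩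

instance : h.jHeart.Additive where
  map_add {X Y f g} := by
    let := G.commShift_jStar
    have := G.exact_jStar
    exact ObjectProperty.hom_ext _ G.jStar.map_add

instance : h.jHeart.Linear F where
  map_smul {X Y} f r := by
    have := G.linear_jStar
    exact ObjectProperty.hom_ext _ (G.jStar.map_smul r f.hom)

include h in
theorem ge0_iLower_shift {Y : CZ} (hY : WZ.ge0 (Y⟦(-1 : ℤ)⟧)) :
    WX.ge0 ((G.iLower.obj Y)⟦(-1 : ℤ)⟧) := by
  let := G.commShift_iLower
  exact WX.ge0_of_iso ((G.iLower.commShiftIso (-1 : ℤ)).app Y) (h.iLower_ge _ hY)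

theorem hasApproximations : HasApproximations h.iHeart h.jHeart where
  isZero_obj N := by
    rw [IsZero.iff_id_eq_zero]
    exact ObjectProperty.hom_ext _ ((G.jStar_iLower N.obj).eq_of_src _ _)
  exists_approx X := by
    let := G.commShift_iLower
    have := G.exact_iLower
    obtain ⟨N, a, Y, g, k, hY, hT⟩ := WZ.exists_heart_approx (h.iShriek_ge _ X.property.2)
    refine ⟨N, ObjectProperty.homMk (G.iLower.map a ≫ G.adj_iShriek.counit.app X.obj),
      fun M f hf => ?_⟩
    obtain ⟨c, hc⟩ := G.exists_factor_of_jStar_map_eq_zero f.hom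
      (WU.heartProp.ι.congr_map hf)
    -- The morphism `c : M ⟶ i_* i^! X` lifts to `i_* N` because `M` has weights `≤ 0` and `i_* Y`
    -- has weights `≥ 1`.
    obtain ⟨b, hb⟩ := Triangle.coyoneda_exact₂ _ (G.iLower.map_distinguished _ hT) c
      (WX.orthogonal M.property.1 (h.ge0_iLower_shift hY) _)
    exact ⟨ObjectProperty.homMk b, ObjectProperty.hom_ext _ ((Category.assoc _ _ _).symm.trans
      ((congrArg (· ≫ G.adj_iShriek.counit.app X.obj) hb.symm).trans hc))⟩

instance : h.jHeart.Full where
  map_surjective {M X} f := by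
    obtain ⟨g, hg⟩ := G.exists_jStar_map_eq f.hom fun k => WX.orthogonal_shift M.property.1
      (h.iLower_ge _ (h.iShriek_ge _ X.property.2)) k
    exact ⟨ObjectProperty.homMk g, ObjectProperty.hom_ext _ hg⟩

/-- The object `j_* V` has weights `≥ 0`, but possibly not `≤ 0`. Removing the part `C₁` of weights
`≥ 1` of `i^* j_* V` corrects this without changing the restriction to `U`: `P` is the fibre of `j_*
V ⟶ i_* C₁`. -/
instance : h.jHeart.EssSurj where
  mem_essImage V := by
    let := G.commShift_iLower
    let := G.commShift_iStar
    let := G.commShift_jStar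
    have := G.exact_iLower
    have := G.exact_iStar
    have := G.exact_jStar
    have := G.iLower_full
    have := G.iLower_faithful
    have := G.jLower_full
    have := G.jLower_faithful
    let M := G.jLower.obj V.obj
    obtain ⟨C₀, C₁, hC₀, hC₁, a, b, k, hC⟩ := WZ.exists_filtration (G.iStar.obj M)
    obtain ⟨P, p, q, hP⟩ := distinguished_cocone_triangle₁ (G.adj_iStar.homEquiv _ _ b)
    have hj := G.jStar.map_distinguished _ hP
    have hi := G.iStar.map_distinguished _ hP
    have hjp : IsIso (G.jStar.map p) :=
      (Triangle.isZero₃_iff_isIso₁ _ hj).1 (G.jStar_iLower C₁)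
    let e : G.jStar.obj P ≅ V.obj :=
      asIso (G.jStar.map p) ≪≫ asIso (G.adj_jLower.counit.app V.obj)
    have hge : WX.ge0 P := WX.ge0_ext (inv_rot_of_distTriang _ hP)
      (h.ge0_iLower_shift hC₁) (h.jLower_ge _ V.property.2)
    have hiP : WZ.le0 (G.iStar.obj P) := by
      -- Since `i^* i_*` is the identity via the counit, `i^*` of the triangle defining `P` is the
      -- weight filtration of `i^* M`, so `i^* P ≅ C₀`.
      have hm : G.iStar.map (G.adj_iStar.homEquiv _ _ b) ≫ G.adj_iStar.counit.app C₁ = 𝟙 _ ≫ b := by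
        rw [Category.id_comp]
        exact (G.adj_iStar.homEquiv_counit (g := G.adj_iStar.homEquiv _ _ b)).symm.trans
          (Equiv.symm_apply_apply _ _)
      obtain ⟨c, hc, hd⟩ := complete_distinguished_triangle_morphism₁ _ _ hi hC
        (𝟙 (G.iStar.obj M)) (G.adj_iStar.counit.app C₁) hm
      have : IsIso c := isIso₁_of_isIso₂₃
        (Triangle.homMk _ _ c (𝟙 _) (G.adj_iStar.counit.app C₁) hc hm hd) hi hC
        (inferInstanceAs (IsIso (𝟙 (G.iStar.obj M))))
        (inferInstanceAs (IsIso (G.adj_iStar.counit.app C₁)))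
      exact WZ.le0_of_iso (asIso c).symm hC₀
    have hle : WX.le0 P := by
      -- `P` is an extension of `i_* i^* P` by `j_! j^* P`, both of weights `≤ 0`.
      obtain ⟨d, hd⟩ := G.triangle_shriek P
      exact WX.le0_ext hd (h.jShriek_le _ (WU.le0_of_iso e.symm V.property.1))
        (h.iLower_le _ hiP)
    exact ⟨⟨P, hle, hge⟩, ⟨ObjectProperty.isoMk _ e⟩⟩

end Gluing.WeightCompatible

end

end WeightGluing

/-! ### The theorem, deduced from `HasApproximations` for the hearts. -/

theorem theorem2
    -- the coefficients: a finite direct product of fields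
    {F : Type*} [CommRing F] {ι : Type*} [Finite ι] (K : ι → Type*) [∀ k, Field (K k)]
    (_e : F ≃+* ∀ k, K k)
    -- three `F`-linear pseudo-Abelian triangulated categories
    {CU : Type*} [Category* CU] [Preadditive CU] [Linear F CU] [HasZeroObject CU]
    [HasShift CU ℤ] [∀ n : ℤ, (shiftFunctor CU n).Additive]
    [∀ n : ℤ, (shiftFunctor CU n).Linear F] [Pretriangulated CU]
    [CategoryTheory.IsTriangulated CU] [IsIdempotentComplete CU]
    {CX : Type*} [Category* CX] [Preadditive CX] [Linear F CX] [HasZeroObject CX]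
    [HasShift CX ℤ] [∀ n : ℤ, (shiftFunctor CX n).Additive]
    [∀ n : ℤ, (shiftFunctor CX n).Linear F] [Pretriangulated CX]
    [CategoryTheory.IsTriangulated CX] [IsIdempotentComplete CX]
    {CZ : Type*} [Category* CZ] [Preadditive CZ] [Linear F CZ] [HasZeroObject CZ]
    [HasShift CZ ℤ] [∀ n : ℤ, (shiftFunctor CZ n).Additive]
    [∀ n : ℤ, (shiftFunctor CZ n).Linear F] [Pretriangulated CZ]
    [CategoryTheory.IsTriangulated CZ] [IsIdempotentComplete CZ]
    -- gluing, and weight structures compatible with it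
    (G : Gluing F CU CX CZ)
    (WU : WeightStructure CU) (WX : WeightStructure CX)
    (WZ : WeightStructure CZ) (h : G.WeightCompatible WU WX WZ) :
    -- `i_*` identifies `C(Z)_{w=0}` with a full, dense subcategory of `C(X)_{w=0}`, and `j^*`
    -- identifies `C(U)_{w=0}` with the quotient category
    (h.iHeart.Full ∧ h.iHeart.Faithful ∧ h.iHeart.essImage.IsStableUnderRetracts ∧
      ∃ E₀ : (imageIdeal F h.iHeart).Quot ≌ WU.Heart,
        IsLinearFunctor F E₀.functor ∧
        Nonempty ((imageIdeal F h.iHeart).proj ⋙ E₀.functor ≅ h.jHeart)) ∧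
    -- un-gluing, if `C(Z)_{w=0}` is semi-primary
    (IsSemiprimary F WZ.Heart →
      -- existence of decompositions `M ⊕ i_* N`
      (∀ X : WX.Heart, Nonempty (Decomposition h.iHeart X)) ∧
      -- uniqueness of decompositions
      (∀ (X : WX.Heart) (D D' : Decomposition h.iHeart X),
        ∃ (α : D.M ≅ D'.M) (β : D.N ≅ D'.N),
          D.Compatible F D' α.hom β.hom ∧
          ∀ (α' : D.M ≅ D'.M) (β' : D.N ≅ D'.N), D.Compatible F D' α'.hom β'.hom →
            (gluingIdeal F h.iHeart).proj.map α'.hom =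
              (gluingIdeal F h.iHeart).proj.map α.hom ∧
            h.jHeart.map α'.hom = h.jHeart.map α.hom ∧
            (gluingIdealSub F h.iHeart).proj.map β'.hom =
              (gluingIdealSub F h.iHeart).proj.map β.hom) ∧
      -- the gluing ideal is nilpotent, and contained in the radical and in the kernel of `j^*`
      (∀ X : WX.Heart, (gluingIdeal F h.iHeart).NilpotentAt X) ∧
      gluingIdeal F h.iHeart ≤ radical F WX.Heart ∧
      (∀ (X Y : WX.Heart) (f : X ⟶ Y),
        f ∈ (gluingIdeal F h.iHeart).carrier X Y → h.jHeart.map f = 0) ∧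
      -- pseudo-Abelian categories
      IsPseudoAbelian WU.Heart ∧
      IsPseudoAbelian (UngluedSub F h.iHeart) ∧
      IsPseudoAbelian (Unglued F h.iHeart) ∧
      -- the equivalence `C(X)_{w=0}^u ≌ C(U)_{w=0} × C(Z)_{w=0}^u` induced by `j^*` and `i_*`
      ∃ E : Unglued F h.iHeart ≌
          WU.Heart × UngluedSub F h.iHeart,
        IsLinearToProd F E.functor ∧
        Nonempty ((gluingIdeal F h.iHeart).proj ⋙ E.functor ⋙
          CategoryTheory.Prod.fst _ _ ≅ h.jHeart) ∧
        Nonempty (h.iHeart ⋙ (gluingIdeal F h.iHeart).proj ⋙ E.functor ⋙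
          CategoryTheory.Prod.snd _ _ ≅ (gluingIdealSub F h.iHeart).proj) ∧
        (∀ M : WX.Heart, HasNoFactorFrom h.iHeart M →
          IsZero (E.functor.obj
            ((gluingIdeal F h.iHeart).proj.obj M)).2) ∧
        -- the intermediate extension `j_{!*}`, corresponding to `(id, 0)`
        (∃ J : WU.Heart ⥤ Unglued F h.iHeart,
          J.Full ∧ J.Faithful ∧ IsLinearFunctor F J ∧
          Nonempty (J ⋙ E.functor ⋙ CategoryTheory.Prod.fst _ _ ≅ 𝟭 WU.Heart) ∧
          ∀ M : WU.Heart, IsZero (E.functor.obj (J.obj M)).2) ∧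
        -- descent of the equivalence to the quotients by the radicals
        ∃ (hX : gluingIdeal F h.iHeart ≤ radical F WX.Heart)
          (hZ : gluingIdealSub F h.iHeart ≤ radical F WZ.Heart)
          (E' : (radical F WX.Heart).Quot ≌
            (radical F WU.Heart).Quot ×
              (radical F WZ.Heart).Quot),
          IsLinearToProd F E'.functor ∧
          Nonempty (HomIdeal.factor hX ⋙ E'.functor ≅
            E.functor ⋙ Functor.prod (radical F WU.Heart).proj
              (HomIdeal.factor hZ))) ∧
    -- semi-primality glues
    (IsSemiprimary F WZ.Heart →
      IsSemiprimary F WU.Heart →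
      IsSemiprimary F WX.Heart) ∧
    -- so does being Wedderburn, over a finite product of perfect fields
    ((∀ k, PerfectField (K k)) →
      IsWedderburn F WZ.Heart →
      IsWedderburn F WU.Heart →
      IsWedderburn F WX.Heart) := by
  have hA := h.hasApproximations
  have := WU.isIdempotentComplete_heart
  have := WX.isIdempotentComplete_heart
  have := WZ.isIdempotentComplete_heart
  have := WX.hasFiniteBiproducts_heart
  have := WZ.hasFiniteBiproducts_heart
  have : HasBinaryBiproducts WX.Heart := hasBinaryBiproducts_of_finite_biproducts _
  have : HasZeroObject WX.Heart := hasZeroObject_of_hasFiniteBiproducts _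
  have : HasZeroObject WZ.Heart := hasZeroObject_of_hasFiniteBiproducts _
  refine ⟨⟨inferInstance, inferInstance, isStableUnderRetracts_essImage _, ?_⟩, fun hB => ?_,
    hA.isSemiprimary, fun _ => hA.isWedderburn⟩
  · have hP : ∀ ⦃X Y : WX.Heart⦄ (f : X ⟶ Y), f ∈ (imageIdeal F h.iHeart).carrier X Y →
        h.jHeart.map f = 0 := fun _ _ f hf => (hA.mem_imageIdeal_iff f).1 hf
    let P := HomIdeal.lift h.jHeart hP
    have : P.Full := HomIdeal.lift_full _ _
    have : P.Faithful := HomIdeal.lift_faithful _ _ fun _ _ f => (hA.mem_imageIdeal_iff f).2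
    have : P.EssSurj := HomIdeal.lift_essSurj _ _
    have : P.IsEquivalence := {}
    exact ⟨P.asEquivalence, ⟨inferInstanceAs P.Additive, inferInstanceAs (P.Linear F)⟩,
      ⟨HomIdeal.projCompLift _ hP⟩⟩
  · let D X := (hA.exists_decomposition hB X).some
    have : (ungluing F D hA).IsEquivalence := {}
    have : HasZeroObject (UngluedSub F h.iHeart) := HomIdeal.hasZeroObject_quot
    have := full_radicalUngluing hB D hA
    have := faithful_radicalUngluing hB D hA
    have := essSurj_radicalUngluing hB D hA
    have : (radicalUngluing h.jHeart hB D).IsEquivalence := {}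
    have hn := hA.nilpotentAt_gluingIdeal hB
    refine ⟨hA.exists_decomposition hB, fun X => Decomposition.exists_unique_compatible hB hA, hn,
      gluingIdeal_le_radical hB, fun _ _ => hA.map_eq_zero_of_mem_gluingIdeal,
      WU.isPseudoAbelian_heart,
      ⟨HomIdeal.hasFiniteBiproducts_quot _,
        HomIdeal.isIdempotentComplete_quot fun N => (hn _).comap _⟩,
      ⟨HomIdeal.hasFiniteBiproducts_quot _, HomIdeal.isIdempotentComplete_quot hn⟩,
      (ungluing F D hA).asEquivalence, isLinearToProd_ungluing F D hA,
      ⟨HomIdeal.projCompLift h.jHeart fun _ _ => hA.map_eq_zero_of_mem_gluingIdeal⟩, ⟨?_⟩,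
      fun M => isZero_secondFunctor_of_noFactor F D,
      exists_functor_of_equivalence_prod _ (isLinearToProd_ungluing F D hA),
      gluingIdeal_le_radical hB, gluingIdealSub_le_radical hB,
      (radicalUngluing h.jHeart hB D).asEquivalence, isLinearToProd_radicalUngluing hB D,
      ⟨factorCompRadicalUngluing hB D hA⟩⟩
    exact Functor.isoWhiskerLeft h.iHeart (HomIdeal.projCompLift (secondFunctor F D)
      fun _ _ => secondFunctor_map_eq_zero F D) ≪≫ secondFunctorIso F D
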